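/- **Notation.** An index is a finite (possibly empty) sequence $\mathbf{k}=(k_1,\dots,k_r)$ of positive integers, and $x$ is a real number with $|x|<1$. For an index with $r=0$ or $k_r\ge 2$ put $\zeta(\mathbf{k})=\sum_{0<m_1<\cdots<m_r} m_1^{-k_1}\cdots m_r^{-k_r}$, and for any index and $N\ge1$ put $$\zeta_N^{(x)}(\mathbf{k})=\sum_{0<m_1<\cdots<m_r<N}\frac{1}{(m_1+x)^{k_1}\cdots(m_r+x)^{k_r}},\qquad \zeta_N^{(x)}(\varnothing)=1 .$$ Let $\gamma$ be Euler's constant and $\psi=\Gamma'/\Gamma$. The polynomial $Z_*^{(x)}(\mathbf{k};T)\in\mathbb{R}[T]$ is characterized by $$\zeta_N^{(x)}(\mathbf{k})=Z_*^{(x)}\bigl(\mathbf{k};\log N-\psi(1+x)\bigr)+O\bigl(N^{-1}\log^pN\bigr)\quad(N\to\infty)\ \text{ for some } p>0 .$$ Write $Z_*=Z_*^{(0)}$. Let $\mathbf{l}^\star$ be the formal sum of the $2^{s-1}$ indices $(l_1\,\square\cdots\square\, l_s)$ in which each $\square$ is a plus sign or a comma ($\varnothing^\star=\varnothing$), and put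 $Z_*^\star(\mathbf{k};T)=Z_*(\mathbf{k}^\star;T)$; functions of indices are extended linearly to formal sums. Let $*$ be the stuffle product, i.e. the bilinear product with unit $\varnothing$ and $(a,\mathbf{k})*(b,\mathbf{l})=(a,\mathbf{k}*(b,\mathbf{l}))+(b,(a,\mathbf{k})*\mathbf{l})+(a+b,\mathbf{k}*\mathbf{l})$. For non-empty indices put $\mathbf{k}\circledast\mathbf{l}=\bigl((k_1,\dots,k_{r-1})*(l_1,\dots,l_{s-1}),\,k_r+l_s\bigr)$, extended bilinearly. The Hoffman dual $\mathbf{k}^\vee$ of a non-empty index is obtained by writing $\mathbf{k}=(1\,\square\cdots\square\,1)$ with plus signs and commas and interchanging the two. The Kawashima function is $$F(\mathbf{k};x)=\sum_{m=1}^\infty(-1)^{m-1}\zeta\bigl((\underbrace{1,\dots,1}_m)\circledast(\mathbf{k}^\vee)^\star\bigr)x^m\quad(\mathbf{k}\ne\varnothing),\qquad F(\varnothing;x)=1 .$$ **Theorem.** Let $|x|<1$. The polynomials $Z_*^{(x)}(\mathbf{l};T)$ and $Z_*(\mathbf{l};T)$ exist and are unique for every index $\mathbf{l}$, and the series defining $F(\mathbf{k};x)$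 and the multiple zeta values in its coefficients converge. For every index $\mathbf{k}=(k_1,\dots,k_r)$ we have, as an identity in $\mathbb{R}[T]$, $$F(\mathbf{k};x)=\sum_{j=0}^r(-1)^{r-j}\,Z_*^\star(k_1,\dots,k_j;T)\;Z_*^{(x)}\bigl(k_r,\dots,k_{j+1};\,T-\gamma-\psi(1+x)\bigr).$$ -/

import Mathlib

open Polynomial Asymptotics Filter

noncomputable section

namespace Kawashima

/-- An index set `(k₁, …, k_r)` of positive integers; `[]` is the empty index set. -/
abbrev Index := List ℕ+

/-- Formal sums of index sets, with non-negative integer multiplicities. -/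
abbrev FormalSum := Multiset Index

/-- The stuffle (harmonic) product `k * l` of index sets. -/
def stuffle : Index → Index → FormalSum
  | [], l => {l}
  | a :: k, [] => {a :: k}
  | a :: k, b :: l =>
      (stuffle k (b :: l)).map (a :: ·) + (stuffle (a :: k) l).map (b :: ·)
        + (stuffle k l).map ((a + b) :: ·)
termination_by k l => k.length + l.length

/-- The product `k ⊛ l = ((k₁, …, k_{r-1}) * (l₁, …, l_{s-1}), k_r + l_s)` of non-empty index
sets (the value is the empty sum if `k` or `l` is empty; this case is never used). -/
def circledast (k l : Index) : FormalSum :=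
  match k.getLast?, l.getLast? with
  | some a, some b => (stuffle k.dropLast l.dropLast).map (fun w => w ++ [a + b])
  | _, _ => 0

/-- Add `a` to the first entry of an index set. -/
def addHead (a : ℕ+) : Index → Index
  | [] => [a]
  | b :: w => (a + b) :: w

/-- `l^⋆`: the formal sum of the index sets `(l₁ □ ⋯ □ l_s)`, each `□` being `+` or a comma. -/
def star : Index → FormalSum
  | [] => {[]}
  | [a] => {[a]}
  | a :: b :: l => (star (b :: l)).map (a :: ·) + (star (b :: l)).map (addHead a)

/-- Write a non-empty index set of weight `w` as `(1 □ 1 □ ⋯ □ 1)` with `w` ones; this is the list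
of the `w - 1` separators, where `true` is a comma and `false` is a plus sign. -/
def separators : Index → List Bool
  | [] => []
  | [a] => List.replicate ((a : ℕ) - 1) false
  | a :: b :: l => List.replicate ((a : ℕ) - 1) false ++ true :: separators (b :: l)

/-- The index set `(1 □ 1 □ ⋯ □ 1)` with the given separators. -/
def ofSeparators : List Bool → Index
  | [] => [1]
  | true :: s => 1 :: ofSeparators s
  | false :: s => addHead 1 (ofSeparators s)

/-- The Hoffman dual `k^∨`: commas and plus signs are interchanged in `(1 □ 1 □ ⋯ □ 1)`. -/
def hoffmanDual (k : Index) : Index :=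
  if k = [] then [] else ofSeparators ((separators k).map not)

/-- The finite sum
`ζ_N^{(x)}(k) = ∑_{0 < m₁ < ⋯ < m_r < N} 1 / ((m₁ + x)^{k₁} ⋯ (m_r + x)^{k_r})`. -/
def hurwitzSum (x : ℝ) (k : Index) (N : ℕ) : ℝ :=
  open Classical in
  ∑ m ∈ (Fintype.piFinset fun _ : Fin k.length => Finset.Ioo 0 N).filter StrictMono,
    ∏ i, 1 / ((m i : ℝ) + x) ^ (k.get i : ℕ)

/-- The term `1 / (m₁^{k₁} ⋯ m_r^{k_r})` of the multiple zeta series, for `0 < m₁ < ⋯ < m_r`. -/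
def mzvTerm (k : Index) (m : {m : Fin k.length → ℕ+ // StrictMono m}) : ℝ :=
  ∏ i, 1 / ((m.1 i : ℕ) : ℝ) ^ (k.get i : ℕ)

/-- The multiple zeta value `ζ(k) = ∑_{0 < m₁ < ⋯ < m_r} 1 / (m₁^{k₁} ⋯ m_r^{k_r})`. -/
def mzv (k : Index) : ℝ := ∑' m, mzvTerm k m

/-- The digamma function `ψ = Γ' / Γ` on the real line. -/
def digamma (s : ℝ) : ℝ := deriv Real.Gamma s / Real.Gamma s

/-- `P(log N - ψ(1+x))` describes `ζ_N^{(x)}(k)` up to `O(N⁻¹ log^p N)` as `N → ∞`. -/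
def IsStuffleReg (x : ℝ) (k : Index) (P : ℝ[X]) : Prop :=
  ∃ p : ℕ, 0 < p ∧
    (fun N : ℕ => hurwitzSum x k N - P.eval (Real.log N - digamma (1 + x)))
      =O[atTop] fun N : ℕ => (N : ℝ)⁻¹ * Real.log N ^ p

/-- The stuffle-regularized polynomial `Z_*^{(x)}(k; T)`: the polynomial characterized by
`IsStuffleReg x k`. -/
def stuffleReg (x : ℝ) (k : Index) : ℝ[X] := Classical.epsilon (IsStuffleReg x k)

/-- `Z_*^⋆(k; T) = Z_*(k^⋆; T)`, where `Z_* = Z_*^{(0)}` is extended linearly to formal sums. -/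
def stuffleRegStar (k : Index) : ℝ[X] := ((star k).map (stuffleReg 0)).sum

/-- The formal sum `(1, …, 1) ⊛ (k^∨)^⋆` with `m` ones. -/
def kawashimaSum (k : Index) (m : ℕ) : FormalSum :=
  (star (hoffmanDual k)).bind (circledast (List.replicate m 1))

/-- The term `(-1)^{m-1} ζ((1, …, 1) ⊛ (k^∨)^⋆) x^m` of the Kawashima series, with `m = n + 1`
ones and `ζ` extended linearly to formal sums. -/
def kawashimaTerm (k : Index) (x : ℝ) (n : ℕ) : ℝ :=
  (-1) ^ n * ((kawashimaSum k (n + 1)).map mzv).sum * x ^ (n + 1)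

/-- The Kawashima function `F(k; x) = ∑_{m ≥ 1} (-1)^{m-1} ζ((1, …, 1) ⊛ (k^∨)^⋆) x^m`, with the
convention `F(∅; x) = 1`. -/
def kawashimaF (k : Index) (x : ℝ) : ℝ :=
  if k = [] then 1 else ∑' n, kawashimaTerm k x n

end Kawashima

end

open Polynomial Asymptotics Filter

noncomputable section

namespace Kawashima

/-! ### Nested sums over a list of points -/

/-! The Kawashima function is the Newton series interpolating the finite star sums of `k`, and the
formula comes from following its difference equation from `x` to `x + N` and letting `N → ∞`.

Expanding binomial coefficients in powers of `x` and interchanging two absolutely convergent sums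
turns the Taylor series into a Newton series whose coefficients are the increments of the star sums
of the Hoffman dual (`hasSum_kawashimaTerm`). Appending an entry `1` to `k` divides these
coefficients by `n + 1`; raising the last entry by one replaces them by their averages. Either
operation corresponds to one factor `y` in the differenced Newton series, which gives `F(k, c; y) -
F(k, c; y - 1) = y^{-c} F(k; y)` (`kawashimaNewton_concat`).

Consequently `∑_j (-1)^{r-j} F(k_1, …, k_j; x + N) ζ_{N+1}^{(x)}(k_r, …, k_{j+1})` does not depend
on `N`, and at `N = 0` it is `F(k; x)` (`kawashimaNewton_eq_sum`). The coefficients are totally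
monotone, so `F(·; x + N)` differs from the star sum at `N` by at most a constant times one
increment of that star sum, which is `O(N⁻¹ log^p N)` (`exists_abs_newton_add_sub_le`). The
alternating sum of products of finite sums therefore tends to `F(k; x)`.

The finite sums are polynomials in `log N` up to `O(N⁻¹ log^p N)` (`exists_logO_hurwitzSum_sub`). So
the right-hand side, a polynomial in `T`, tends to `F(k; x)` along `T = log N + γ`; a polynomial
with a finite limit at infinity is constant. -/

/-- `∑ p_{i₁}^{l₁} ⋯ p_{i_r}^{l_r}` over `i₁ < ⋯ < i_r`, where the `p_i` are the members of the
first list. -/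
def nestedSum : List ℝ → Index → ℝ
  | _, [] => 1
  | [], _ :: _ => 0
  | p :: L, c :: l => nestedSum L (c :: l) + p ^ (c : ℕ) * nestedSum L l

@[simp] theorem nestedSum_nil_right (L : List ℝ) : nestedSum L [] = 1 := by
  cases L <;> simp [nestedSum]

@[simp] theorem nestedSum_nil_cons (c : ℕ+) (l : Index) : nestedSum [] (c :: l) = 0 := by
  simp [nestedSum]

theorem nestedSum_cons_cons (p : ℝ) (L : List ℝ) (c : ℕ+) (l : Index) :
    nestedSum (p :: L) (c :: l) = nestedSum L (c :: l) + p ^ (c : ℕ) * nestedSum L l := by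
  simp [nestedSum]

/-- The defining recursion removes the smallest point. Increasing `N` adds a largest point, which
calls for the recursion at the other end. -/
theorem nestedSum_concat_concat (L : List ℝ) (p : ℝ) (l : Index) (c : ℕ+) :
    nestedSum (L ++ [p]) (l ++ [c]) = nestedSum L (l ++ [c]) + p ^ (c : ℕ) * nestedSum L l := by
  induction L generalizing l with
  | nil =>
    cases l with
    | nil => simp [nestedSum]
    | cons a l =>
      cases l <;> simp [nestedSum]
  | cons q L ih =>
    cases l with
    | nil =>
      have := ih []
      simp only [List.nil_append, nestedSum_nil_right, mul_one] at this
      simp only [List.cons_append, List.nil_append, nestedSum_cons_cons, this, nestedSum_nil_right]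
      ring
    | cons a l =>
      have h1 := ih (a :: l)
      have h2 := ih l
      simp only [List.cons_append] at h1 ⊢
      rw [nestedSum_cons_cons, h1, h2, nestedSum_cons_cons, nestedSum_cons_cons]
      ring

theorem sum_map_nestedSum_cons (s : FormalSum) (p : ℝ) (L : List ℝ) (c : ℕ+) :
    ((s.map (c :: ·)).map (nestedSum (p :: L))).sum =
      ((s.map (c :: ·)).map (nestedSum L)).sum + p ^ (c : ℕ) * (s.map (nestedSum L)).sum := by
  simp only [Multiset.map_map, Function.comp_def, nestedSum_cons_cons, Multiset.sum_map_add,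
    Multiset.sum_map_mul_left]

/-- Nested sums turn the stuffle product into the product. -/
theorem nestedSum_stuffle (L : List ℝ) (k l : Index) :
    ((stuffle k l).map (nestedSum L)).sum = nestedSum L k * nestedSum L l := by
  induction L generalizing k l with
  | nil =>
    cases k with
    | nil => simp [stuffle]
    | cons a k =>
      cases l with
      | nil => simp [stuffle]
      | cons b l =>
        simp [stuffle]
  | cons p L ih =>
    cases k with
    | nil => simp [stuffle]
    | cons a k =>
      cases l with
      | nil => simp [stuffle]
      | cons b l =>
        -- In `(A + p^a B)(C + p^b D)` the term `AC` is `h`; the terms with `p^a`, `p^b` and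
        -- `p^(a+b)` match the three branches of the stuffle recursion.
        have h := ih (a :: k) (b :: l)
        rw [stuffle] at h ⊢
        simp only [Multiset.map_add, Multiset.sum_add] at h ⊢
        simp only [sum_map_nestedSum_cons, ih, nestedSum_cons_cons, PNat.add_coe, pow_add]
        linear_combination h

/-! ### The finite sums `ζ_N^{(x)}` as nested sums -/

/-- The finite sum over `a < m₁ < ⋯ < m_r < N`. -/
def hurwitzSumFrom (x : ℝ) (a N : ℕ) (k : Index) : ℝ :=
  open Classical in
  ∑ m ∈ (Fintype.piFinset fun _ : Fin k.length => Finset.Ioo a N).filter StrictMono,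
    ∏ i, 1 / ((m i : ℝ) + x) ^ (k.get i : ℕ)

theorem hurwitzSumFrom_nil (x : ℝ) (a N : ℕ) : hurwitzSumFrom x a N [] = 1 := by
  have h : ((Fintype.piFinset fun _ : Fin ([] : Index).length => Finset.Ioo a N)) =
      {fun i => Fin.elim0 i} := by
    ext m
    simp only [Fintype.mem_piFinset, Finset.mem_singleton]
    exact ⟨fun _ => funext fun i => Fin.elim0 i, fun _ i => Fin.elim0 i⟩
  have h2 : StrictMono (fun i : Fin ([] : Index).length => (Fin.elim0 i : ℕ)) :=
    fun i => Fin.elim0 i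
  rw [hurwitzSumFrom, h, Finset.filter_true_of_mem]
  · simp
  · intro m hm
    rw [Finset.mem_singleton.mp hm]
    exact h2

theorem hurwitzSumFrom_cons_of_le (x : ℝ) {a N : ℕ} (h : N ≤ a + 1) (c : ℕ+) (l : Index) :
    hurwitzSumFrom x a N (c :: l) = 0 := by
  rw [hurwitzSumFrom, Finset.sum_eq_zero]
  intro m hm
  have := (Fintype.mem_piFinset.mp (Finset.mem_filter.mp hm).1) (0 : Fin (l.length + 1))
  simp only [Finset.mem_Ioo] at this
  omega

/-- The tuples are split according to whether `m₁ = a + 1`; removing that entry raises the lower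
bound, hence the variable `a`. -/
theorem hurwitzSumFrom_cons (x : ℝ) {a N : ℕ} (h : a + 1 < N) (c : ℕ+) (l : Index) :
    hurwitzSumFrom x a N (c :: l) = hurwitzSumFrom x (a + 1) N (c :: l) +
      (1 / (((a + 1 : ℕ) : ℝ) + x)) ^ (c : ℕ) * hurwitzSumFrom x (a + 1) N l := by
  classical
  rw [add_comm]
  unfold hurwitzSumFrom
  rw [Finset.mul_sum, ← Finset.sum_filter_add_sum_filter_not _
    (fun m : Fin (c :: l).length → ℕ => m (0 : Fin (l.length + 1)) = a + 1)]
  congr 1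
  · symm
    refine Finset.sum_bij'
      (fun (m : Fin l.length → ℕ) _ => (Fin.cons (a + 1) m : Fin (l.length + 1) → ℕ))
      (fun (m : Fin (l.length + 1) → ℕ) _ => Fin.tail m) ?_ ?_ ?_ ?_ ?_
    · intro m hm
      simp only [Finset.mem_filter, Fintype.mem_piFinset, Finset.mem_Ioo] at hm ⊢
      refine ⟨⟨fun i => ?_, ?_⟩, by simp⟩
      · refine Fin.cases ?_ (fun j => ?_) i
        · simp; omega
        · have := hm.1 j
          simp; omega
      · refine Fin.strictMono_iff_lt_succ.mpr fun i => ?_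
        have key : ∀ j : Fin l.length, a + 1 < m j := fun j => (hm.1 j).1
        rcases i with ⟨i, hi⟩
        cases i with
        | zero => exact key ⟨0, hi⟩
        | succ i =>
          have : m ⟨i, by omega⟩ < m ⟨i + 1, hi⟩ := hm.2 (by simp [Fin.lt_def])
          exact this
    · intro m hm
      simp only [Finset.mem_filter, Fintype.mem_piFinset, Finset.mem_Ioo] at hm ⊢
      refine ⟨fun i => ⟨?_, (hm.1.1 i.succ).2⟩, fun i j hij => hm.1.2 (Fin.succ_lt_succ_iff.mpr hij)⟩
      have := hm.1.2 (Fin.succ_pos i)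
      rw [hm.2] at this
      exact this
    · intro m hm
      simp
    · intro m hm
      have := (Finset.mem_filter.mp hm).2
      change (Fin.cons (a + 1) (Fin.tail m) : Fin (l.length + 1) → ℕ) = m
      rw [← this]
      exact Fin.cons_self_tail m
    · intro m hm
      erw [Fin.prod_univ_succ]
      simp
  · refine Finset.sum_congr ?_ fun _ _ => rfl
    ext m
    simp only [Finset.mem_filter, Fintype.mem_piFinset, Finset.mem_Ioo]
    constructor
    · rintro ⟨⟨h1, h2⟩, h3⟩
      refine ⟨fun i => ⟨?_, (h1 i).2⟩, h2⟩
      have h4 := (h1 (0 : Fin (l.length + 1))).1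
      have h5 : m (0 : Fin (l.length + 1)) ≤ m i := h2.monotone (Fin.zero_le _)
      omega
    · rintro ⟨h1, h2⟩
      refine ⟨⟨fun i => ⟨?_, (h1 i).2⟩, h2⟩, ?_⟩
      · have := (h1 i).1
        omega
      · have := (h1 (0 : Fin (l.length + 1))).1
        omega

theorem hurwitzSumFrom_eq_nestedSum (x : ℝ) (a d : ℕ) (l : Index) :
    hurwitzSumFrom x a (a + 1 + d) l =
      nestedSum ((List.range' (a + 1) d).map fun m : ℕ => 1 / ((m : ℝ) + x)) l := by
  induction d generalizing a l with
  | zero =>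
    cases l with
    | nil => simp [hurwitzSumFrom_nil]
    | cons c l => simp [hurwitzSumFrom_cons_of_le]
  | succ d ih =>
    cases l with
    | nil => simp [hurwitzSumFrom_nil]
    | cons c l =>
      rw [hurwitzSumFrom_cons x (by omega), List.range'_succ, List.map_cons, nestedSum_cons_cons,
        ← ih, ← ih]
      rw [show a + 1 + (d + 1) = a + 1 + 1 + d by ring]

theorem hurwitzSum_succ_eq_nestedSum (x : ℝ) (l : Index) (N : ℕ) :
    hurwitzSum x l (N + 1) =
      nestedSum ((List.range' 1 N).map fun m : ℕ => 1 / ((m : ℝ) + x)) l := by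
  have := hurwitzSumFrom_eq_nestedSum x 0 N l
  rw [show 0 + 1 + N = N + 1 by ring] at this
  exact this

@[simp] theorem hurwitzSum_nil (x : ℝ) (N : ℕ) : hurwitzSum x [] N = 1 :=
  hurwitzSumFrom_nil x 0 N

theorem hurwitzSum_one_of_ne_nil (x : ℝ) {l : Index} (hl : l ≠ []) : hurwitzSum x l 1 = 0 := by
  obtain ⟨c, l, rfl⟩ := List.exists_cons_of_ne_nil hl
  exact hurwitzSumFrom_cons_of_le x le_rfl c l

theorem hurwitzSum_concat (x : ℝ) (l : Index) (c : ℕ+) (N : ℕ) :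
    hurwitzSum x (l ++ [c]) (N + 2) = hurwitzSum x (l ++ [c]) (N + 1) +
      (1 / (((N + 1 : ℕ) : ℝ) + x)) ^ (c : ℕ) * hurwitzSum x l (N + 1) := by
  rw [hurwitzSum_succ_eq_nestedSum, hurwitzSum_succ_eq_nestedSum, hurwitzSum_succ_eq_nestedSum,
    List.range'_1_concat, List.map_append, List.map_singleton, nestedSum_concat_concat]
  rw [add_comm 1 N]

theorem hurwitzSum_stuffle (x : ℝ) (k l : Index) (N : ℕ) :
    ((stuffle k l).map fun w => hurwitzSum x w (N + 1)).sum =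
      hurwitzSum x k (N + 1) * hurwitzSum x l (N + 1) := by
  simp only [hurwitzSum_succ_eq_nestedSum]
  exact nestedSum_stuffle _ k l

theorem hurwitzSum_nonneg (l : Index) (N : ℕ) : 0 ≤ hurwitzSum 0 l N :=
  Finset.sum_nonneg fun m _ => Finset.prod_nonneg fun i _ => by positivity

/-- The generating polynomial of the sums with all exponents equal to `1`. -/
theorem prod_one_add_eq_sum_hurwitzSum (t : ℝ) (n M : ℕ) (hM : n < M) :
    ∏ i ∈ Finset.range n, (1 + t / ((i : ℝ) + 1)) =
      ∑ j ∈ Finset.range M, t ^ j * hurwitzSum 0 (List.replicate j 1) (n + 1) := by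
  induction n generalizing M with
  | zero =>
    obtain ⟨M, rfl⟩ := Nat.exists_eq_succ_of_ne_zero hM.ne'
    rw [Finset.sum_range_succ', Finset.sum_eq_zero]
    · simp
    · intro j _
      rw [zero_add, hurwitzSum_one_of_ne_nil _ (by simp), mul_zero]
  | succ n ih =>
    obtain ⟨M, rfl⟩ := Nat.exists_eq_succ_of_ne_zero (by omega : M ≠ 0)
    rw [Finset.prod_range_succ, mul_add, mul_one, Finset.sum_range_succ']
    have h : ∀ j : ℕ, t ^ (j + 1) * hurwitzSum 0 (List.replicate (j + 1) 1) (n + 1 + 1) =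
        t ^ (j + 1) * hurwitzSum 0 (List.replicate (j + 1) 1) (n + 1) +
          (t ^ j * hurwitzSum 0 (List.replicate j 1) (n + 1)) * (t / ((n : ℝ) + 1)) := by
      intro j
      rw [List.replicate_succ', hurwitzSum_concat]
      push_cast
      simp only [pow_one, add_zero]
      ring
    simp only [h, Finset.sum_add_distrib, ← Finset.sum_mul]
    rw [← ih M (by omega)]
    -- The two copies of the product are expanded with `M` and with `M + 1` terms, which is why the
    -- cutoff is left free in the induction.
    nth_rewrite 1 [ih (M + 1) (by omega)]
    rw [Finset.sum_range_succ' _ M]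
    simp only [List.replicate_zero, hurwitzSum_nil]
    ring

/-! ### Star sums and Hoffman duals, read from the last entry -/

/-- Add `c` to the last entry of an index set. -/
def addLast (c : ℕ+) (l : Index) : Index := (addHead c l.reverse).reverse

@[simp] theorem addLast_concat (c b : ℕ+) (l : Index) : addLast c (l ++ [b]) = l ++ [c + b] := by
  simp [addLast, addHead]

theorem addLast_cons (c a : ℕ+) {l : Index} (hl : l ≠ []) :
    addLast c (a :: l) = a :: addLast c l := by
  rcases List.eq_nil_or_concat' l with rfl | ⟨w, b, rfl⟩
  · exact absurd rfl hl
  · rw [← List.cons_append, addLast_concat, addLast_concat, List.cons_append]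

theorem addHead_ne_nil (a : ℕ+) (l : Index) : addHead a l ≠ [] := by
  cases l <;> simp [addHead]

theorem addLast_addHead (c a : ℕ+) {l : Index} (hl : l ≠ []) :
    addLast c (addHead a l) = addHead a (addLast c l) := by
  obtain ⟨b, l, rfl⟩ := List.exists_cons_of_ne_nil hl
  cases l with
  | nil => simp [addLast, addHead, add_left_comm]
  | cons d l =>
    rw [addLast_cons c b (by simp)]
    simp only [addHead]
    rw [addLast_cons c _ (by simp)]

theorem ne_nil_of_mem_star {v l : Index} (hv : v ≠ []) (hl : l ∈ star v) : l ≠ [] := by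
  match v with
  | [] => exact absurd rfl hv
  | [a] =>
    rw [star, Multiset.mem_singleton] at hl
    simp [hl]
  | a :: b :: v =>
    rw [star, Multiset.mem_add, Multiset.mem_map, Multiset.mem_map] at hl
    rcases hl with ⟨w, _, rfl⟩ | ⟨w, _, rfl⟩
    · simp
    · exact addHead_ne_nil a w

/-- `star` branches on the first separator; finite star sums grow at the largest variable and need
the branching on the last one. -/
theorem star_concat (v : Index) (hv : v ≠ []) (c : ℕ+) :
    star (v ++ [c]) = (star v).map (· ++ [c]) + (star v).map (addLast c) := by
  match v with
  | [] => exact absurd rfl hv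
  | [a] =>
    simp [star, addLast, addHead, add_comm]
  | a :: b :: v =>
    have ih := star_concat (b :: v) (by simp) c
    have e1 : (star (b :: v)).map (fun l => a :: addLast c l) =
        (star (b :: v)).map (fun l => addLast c (a :: l)) :=
      Multiset.map_congr rfl fun l hl =>
        (addLast_cons c a (ne_nil_of_mem_star (by simp) hl)).symm
    have e2 : (star (b :: v)).map (fun l => addHead a (addLast c l)) =
        (star (b :: v)).map (fun l => addLast c (addHead a l)) :=
      Multiset.map_congr rfl fun l hl =>
        (addLast_addHead c a (ne_nil_of_mem_star (by simp) hl)).symm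
    have e3 : (star (b :: v)).map (fun l => addHead a (l ++ [c])) =
        (star (b :: v)).map (fun l => addHead a l ++ [c]) := by
      refine Multiset.map_congr rfl fun l hl => ?_
      obtain ⟨d, l, rfl⟩ := List.exists_cons_of_ne_nil (ne_nil_of_mem_star (by simp) hl)
      simp [addHead]
    simp only [List.cons_append, star] at ih ⊢
    rw [ih]
    simp only [Multiset.map_add, Multiset.map_map, Function.comp_def, List.cons_append]
    rw [e1, e2, e3]
    abel

theorem ofSeparators_ne_nil (s : List Bool) : ofSeparators s ≠ [] := by
  rcases s with _ | ⟨_ | _, s⟩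
  · simp [ofSeparators]
  · exact addHead_ne_nil 1 _
  · simp [ofSeparators]

theorem ofSeparators_concat_true (s : List Bool) :
    ofSeparators (s ++ [true]) = ofSeparators s ++ [1] := by
  induction s with
  | nil => simp [ofSeparators]
  | cons b s ih =>
    cases b
    · simp only [List.cons_append, ofSeparators, ih]
      obtain ⟨d, l, h⟩ := List.exists_cons_of_ne_nil (ofSeparators_ne_nil s)
      simp [h, addHead]
    · simp [ofSeparators, ih]

theorem ofSeparators_concat_false (s : List Bool) :
    ofSeparators (s ++ [false]) = addLast 1 (ofSeparators s) := by
  induction s with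
  | nil => simp [ofSeparators, addLast, addHead]
  | cons b s ih =>
    cases b
    · simp only [List.cons_append, ofSeparators, ih]
      rw [addLast_addHead _ _ (ofSeparators_ne_nil s)]
    · simp only [List.cons_append, ofSeparators, ih]
      rw [addLast_cons _ _ (ofSeparators_ne_nil s)]

theorem separators_concat_one (k : Index) (hk : k ≠ []) :
    separators (k ++ [1]) = separators k ++ [true] := by
  match k with
  | [] => exact absurd rfl hk
  | [a] => simp [separators]
  | a :: b :: k =>
    have ih := separators_concat_one (b :: k) (by simp)
    simp only [List.cons_append, separators] at ih ⊢
    rw [ih]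
    simp

theorem separators_concat_one_add (k : Index) (c : ℕ+) :
    separators (k ++ [1 + c]) = separators (k ++ [c]) ++ [false] := by
  match k with
  | [] =>
    obtain ⟨d, hd⟩ := Nat.exists_eq_succ_of_ne_zero c.pos.ne'
    simp [separators, hd, List.replicate_succ']
  | [a] =>
    have ih := separators_concat_one_add [] c
    simp only [List.cons_append, List.nil_append, separators] at ih ⊢
    rw [ih]
    simp
  | a :: b :: k =>
    have ih := separators_concat_one_add (b :: k) c
    simp only [List.cons_append, separators] at ih ⊢
    rw [ih]
    simp

theorem hoffmanDual_ne_nil {k : Index} (hk : k ≠ []) : hoffmanDual k ≠ [] := by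
  simpa [hoffmanDual, hk] using ofSeparators_ne_nil _

theorem hoffmanDual_singleton_one : hoffmanDual [1] = [1] := by
  simp [hoffmanDual, separators, ofSeparators]

/-- A new final entry `1` is a final comma, which duality turns into a plus sign. In the next lemma
a final plus sign becomes a comma. These two moves generate all indices from `[1]`. -/
theorem hoffmanDual_concat_one {k : Index} (hk : k ≠ []) :
    hoffmanDual (k ++ [1]) = addLast 1 (hoffmanDual k) := by
  simp [hoffmanDual, hk, separators_concat_one k hk, ofSeparators_concat_false]

theorem hoffmanDual_concat_one_add (k : Index) (c : ℕ+) :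
    hoffmanDual (k ++ [1 + c]) = hoffmanDual (k ++ [c]) ++ [1] := by
  simp [hoffmanDual, separators_concat_one_add, ofSeparators_concat_true]

/-! ### The finite star sums -/

/-- The finite star sum `∑_{0 < m₁ ≤ ⋯ ≤ m_r ≤ n} 1 / (m₁^{v₁} ⋯ m_r^{v_r})`. -/
def starSum (v : Index) (n : ℕ) : ℝ := ((star v).map fun l => hurwitzSum 0 l (n + 1)).sum

@[simp] theorem starSum_nil (n : ℕ) : starSum [] n = 1 := by
  simp [starSum, star]

theorem starSum_zero {v : Index} (hv : v ≠ []) : starSum v 0 = 0 := by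
  refine Multiset.sum_eq_zero fun y hy => ?_
  obtain ⟨l, hl, rfl⟩ := Multiset.mem_map.mp hy
  exact hurwitzSum_one_of_ne_nil 0 (ne_nil_of_mem_star hv hl)

theorem starSum_concat_succ (v : Index) (c : ℕ+) (n : ℕ) :
    starSum (v ++ [c]) (n + 1) =
      starSum (v ++ [c]) n + (1 / ((n : ℝ) + 1)) ^ (c : ℕ) * starSum v (n + 1) := by
  by_cases hv : v = []
  · subst hv
    have := hurwitzSum_concat 0 [] c n
    simp only [List.nil_append] at this
    simp [starSum, star, this]
  · unfold starSum
    rw [star_concat v hv]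
    simp only [Multiset.map_add, Multiset.sum_add, Multiset.map_map, Function.comp_def]
    -- Merging `c` into the last entry contributes `(n + 1)^{-c}` times the increment of the sum for
    -- `l`. Together with the comma terms this moves the inner sum to `n + 1`, as the weak
    -- inequality requires.
    have e : ((star v).map fun l => hurwitzSum 0 (addLast c l) (n + 1 + 1)) =
        (star v).map fun l => hurwitzSum 0 (addLast c l) (n + 1) + (1 / ((n : ℝ) + 1)) ^ (c : ℕ) *
          (hurwitzSum 0 l (n + 1 + 1) - hurwitzSum 0 l (n + 1)) := by
      refine Multiset.map_congr rfl fun l hl => ?_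
      rcases List.eq_nil_or_concat' l with rfl | ⟨w, b, rfl⟩
      · exact absurd rfl (ne_nil_of_mem_star hv hl)
      · rw [addLast_concat, hurwitzSum_concat, hurwitzSum_concat]
        push_cast
        ring
    rw [e]
    simp only [hurwitzSum_concat, Multiset.sum_map_add, Multiset.sum_map_mul_left,
      Multiset.sum_map_sub]
    push_cast
    ring

theorem starSum_nonneg (v : Index) (n : ℕ) : 0 ≤ starSum v n := by
  refine Multiset.sum_nonneg fun y hy => ?_
  obtain ⟨l, _, rfl⟩ := Multiset.mem_map.mp hy
  exact hurwitzSum_nonneg l _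

/-! ### Signed binomial coefficients -/

/-- `(-1)^n * binom z n`. -/
def signedBinom (n : ℕ) (z : ℝ) : ℝ := ∏ i ∈ Finset.range n, ((i : ℝ) - z) / ((i : ℝ) + 1)

@[simp] theorem signedBinom_zero (z : ℝ) : signedBinom 0 z = 1 := by simp [signedBinom]

theorem signedBinom_succ (n : ℕ) (z : ℝ) :
    signedBinom (n + 1) z = signedBinom n z * (((n : ℝ) - z) / ((n : ℝ) + 1)) := by
  rw [signedBinom, Finset.prod_range_succ, signedBinom]

theorem signedBinom_succ_zero (n : ℕ) : signedBinom (n + 1) 0 = 0 := by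
  simp [signedBinom, Finset.prod_range_succ']

/-- Absorption: `(n + 1) binom z (n + 1) = z binom (z - 1) n`. -/
theorem succ_mul_signedBinom_succ (n : ℕ) (z : ℝ) :
    ((n : ℝ) + 1) * signedBinom (n + 1) z = -z * signedBinom n (z - 1) := by
  induction n with
  | zero => simp [signedBinom]
  | succ n ih =>
    have h1 : ((n : ℝ) + 1) ≠ 0 := by positivity
    have h2 : ((n : ℝ) + 1 + 1) ≠ 0 := by positivity
    rw [signedBinom_succ (n + 1), signedBinom_succ n (z - 1)]
    push_cast
    field_simp
    linear_combination ((n : ℝ) + 1 - z) * ih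

theorem signedBinom_sub_one_sub (n : ℕ) (z : ℝ) :
    signedBinom n (z - 1) - signedBinom (n + 1) (z - 1) = -signedBinom (n + 1) z := by
  have h1 : ((n : ℝ) + 1) ≠ 0 := by positivity
  have h := succ_mul_signedBinom_succ n z
  rw [signedBinom_succ n (z - 1)]
  field_simp
  linear_combination h

/-- `binom z n = O(n^{-1-z})`. -/
theorem exists_abs_signedBinom_le {z : ℝ} (hz : -1 < z) :
    ∃ C, 0 ≤ C ∧ ∀ n : ℕ, |signedBinom n z| ≤ C * ((n : ℝ) + 1) ^ (-(1 + z)) := by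
  -- `|binom z n| (n + 1)^(1 + z)` is nonincreasing from `n ≥ z` on, by `1 - u ≤ exp (-u)` and `log
  -- ((n + 2) / (n + 1)) ≤ 1 / (n + 1)`.
  have step : ∀ n : ℕ, z ≤ n →
      |signedBinom (n + 1) z| * ((n : ℝ) + 2) ^ (1 + z) ≤
        |signedBinom n z| * ((n : ℝ) + 1) ^ (1 + z) := by
    intro n hn
    have h1 : (0 : ℝ) < (n : ℝ) + 1 := by positivity
    have h2 : (0 : ℝ) < (n : ℝ) + 2 := by positivity
    have hq : ((n : ℝ) - z) / ((n : ℝ) + 1) = 1 - (1 + z) / ((n : ℝ) + 1) := by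
      field_simp; ring
    have hlog : Real.log ((n : ℝ) + 2) - Real.log ((n : ℝ) + 1) ≤ 1 / ((n : ℝ) + 1) := by
      rw [← Real.log_div h2.ne' h1.ne']
      refine (Real.log_le_sub_one_of_pos (by positivity)).trans (le_of_eq ?_)
      field_simp; ring
    have hb : ((n : ℝ) - z) / ((n : ℝ) + 1) * ((n : ℝ) + 2) ^ (1 + z) ≤
        ((n : ℝ) + 1) ^ (1 + z) := by
      rw [Real.rpow_def_of_pos h1, Real.rpow_def_of_pos h2, hq]
      calc _ ≤ Real.exp (-((1 + z) / ((n : ℝ) + 1))) * Real.exp (Real.log ((n : ℝ) + 2) * (1 + z)) := by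
            gcongr
            exact Real.one_sub_le_exp_neg _
        _ ≤ _ := by
            rw [← Real.exp_add]
            gcongr
            have := mul_le_mul_of_nonneg_left hlog (by linarith : 0 ≤ 1 + z)
            rw [mul_one_div] at this
            linarith
    rw [signedBinom_succ, abs_mul, abs_of_nonneg (div_nonneg (by linarith) h1.le), mul_assoc]
    gcongr
  obtain ⟨M, hM⟩ := exists_nat_ge z
  set g : ℕ → ℝ := fun n => |signedBinom n z| * ((n : ℝ) + 1) ^ (1 + z) with hg
  have hg0 : ∀ n, 0 ≤ g n := fun n => by positivity
  have hmono : ∀ n, M ≤ n → g n ≤ g M := by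
    intro n hn
    induction n, hn using Nat.le_induction with
    | base => exact le_rfl
    | succ n hn ih =>
      refine le_trans ?_ ih
      have := step n (hM.trans (by exact_mod_cast hn))
      simp only [hg]
      push_cast
      rwa [add_assoc, one_add_one_eq_two]
  refine ⟨∑ i ∈ Finset.range (M + 1), g i, Finset.sum_nonneg fun i _ => hg0 i, fun n => ?_⟩
  have h1 : (0 : ℝ) < (n : ℝ) + 1 := by positivity
  have : g n ≤ ∑ i ∈ Finset.range (M + 1), g i := by
    rcases le_total n M with h | h
    · exact Finset.single_le_sum (f := g) (fun i _ => hg0 i) (Finset.mem_range.mpr (by omega))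
    · exact (hmono n h).trans
        (Finset.single_le_sum (f := g) (fun i _ => hg0 i) (Finset.mem_range.mpr (by omega)))
  rw [Real.rpow_neg h1.le, ← div_eq_mul_inv, le_div_iff₀ (by positivity)]
  exact this

theorem exists_one_add_log_pow_le (q : ℕ) {δ : ℝ} (hδ : 0 < δ) :
    ∃ D, 0 ≤ D ∧ ∀ t : ℝ, 1 ≤ t → (1 + Real.log t) ^ q ≤ D * t ^ δ := by
  -- Dividing by `q + 1` instead of `q` covers `q = 0`.
  set ε : ℝ := δ / (q + 1)
  have hε : 0 < ε := by positivity
  refine ⟨(1 + 1 / ε) ^ q, by positivity, fun t ht => ?_⟩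
  have h0 : 0 ≤ Real.log t := Real.log_nonneg ht
  have h1 : 1 + Real.log t ≤ (1 + 1 / ε) * t ^ ε := by
    have a := Real.log_le_rpow_div (by linarith : 0 ≤ t) hε
    have b := Real.one_le_rpow ht hε.le
    rw [add_mul, one_mul, one_div_mul_eq_div]
    linarith
  calc (1 + Real.log t) ^ q ≤ ((1 + 1 / ε) * t ^ ε) ^ q := by gcongr
    _ = (1 + 1 / ε) ^ q * t ^ (ε * q) := by
        rw [mul_pow, ← Real.rpow_natCast (t ^ ε), ← Real.rpow_mul (by linarith)]
    _ ≤ _ := by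
        gcongr
        have : ε * (q + 1) = δ := by simp only [ε]; field_simp
        linarith

/-! ### Newton series -/

/-- `|a n|` is at most a power of `1 + log (n + 1)` divided by `n + 1`. -/
def LogBounded (a : ℕ → ℝ) : Prop :=
  ∃ q : ℕ, ∀ n : ℕ, |a n| ≤ (1 + Real.log ((n : ℝ) + 1)) ^ q / ((n : ℝ) + 1)

theorem LogBounded.mono {a b : ℕ → ℝ} (ha : LogBounded a) (h : ∀ n, |b n| ≤ |a n|) :
    LogBounded b := by
  obtain ⟨q, hq⟩ := ha
  exact ⟨q, fun n => (h n).trans (hq n)⟩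

/-- Half of the power saving `ε` absorbs the logarithms; the other half gives convergence. -/
theorem LogBounded.summable_mul {a u : ℕ → ℝ} (ha : LogBounded a) {C ε : ℝ} (hε : 0 < ε)
    (hu : ∀ n : ℕ, |u n| ≤ C * ((n : ℝ) + 1) ^ (-ε)) : Summable fun n => u n * a n := by
  obtain ⟨q, hq⟩ := ha
  obtain ⟨D, hD, hlog⟩ := exists_one_add_log_pow_le q (half_pos hε)
  have hs : Summable fun n : ℕ => C * D * ((n : ℝ) + 1) ^ (-1 - ε / 2) := by
    refine Summable.mul_left _ ?_
    have := (summable_nat_add_iff 1).mpr (Real.summable_nat_rpow (p := -1 - ε / 2) |>.mpr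
      (by linarith))
    simpa using this
  refine Summable.of_norm_bounded hs fun n => ?_
  have h1 : (0 : ℝ) < (n : ℝ) + 1 := by positivity
  have hl := hlog ((n : ℝ) + 1) (by linarith [n.cast_nonneg (α := ℝ)])
  rw [Real.norm_eq_abs, abs_mul]
  calc |u n| * |a n| ≤ (C * ((n : ℝ) + 1) ^ (-ε)) * (D * ((n : ℝ) + 1) ^ (ε / 2) / ((n : ℝ) + 1)) := by
        have h2 := (abs_nonneg (u n)).trans (hu n)
        have := (hq n).trans (div_le_div_of_nonneg_right hl h1.le)
        exact mul_le_mul (hu n) this (abs_nonneg _) h2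
    _ = C * D * ((n : ℝ) + 1) ^ (-1 - ε / 2) := by
        rw [show -1 - ε / 2 = -ε + ε / 2 + (-1) by ring, Real.rpow_add h1, Real.rpow_add h1,
          Real.rpow_neg_one]
        ring

theorem LogBounded.summable_signedBinom {a : ℕ → ℝ} (ha : LogBounded a) {z : ℝ} (hz : -1 < z) :
    Summable fun n => signedBinom n z * a n := by
  obtain ⟨C, _, hC⟩ := exists_abs_signedBinom_le hz
  exact ha.summable_mul (by linarith : 0 < 1 + z) hC

theorem LogBounded.summable_signedBinom_succ {a : ℕ → ℝ} (ha : LogBounded a) {z : ℝ}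
    (hz : -1 < z) : Summable fun n => signedBinom (n + 1) z * a n := by
  obtain ⟨C, hC0, hC⟩ := exists_abs_signedBinom_le hz
  refine ha.summable_mul (by linarith : 0 < 1 + z) (C := C) fun n => (hC (n + 1)).trans ?_
  gcongr C * ?_
  push_cast
  exact Real.rpow_le_rpow_of_nonpos (by positivity) (by linarith) (by linarith)

/-- The Newton series `∑_{n ≥ 1} (-1)^{n-1} a_n binom y n`, with `a_{n+1} = a n`. -/
def newton (a : ℕ → ℝ) (y : ℝ) : ℝ := -∑' n, signedBinom (n + 1) y * a n

/-- The Newton series of the difference `newton a y - newton a (y - 1)`. -/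
def newtonDiff (a : ℕ → ℝ) (y : ℝ) : ℝ := ∑' n, signedBinom n (y - 1) * a n

@[simp] theorem newton_zero (a : ℕ → ℝ) : newton a 0 = 0 := by
  simp [newton, signedBinom_succ_zero]

/-- Pascal's rule term by term; `0 < y` makes the series at `y - 1` converge as well. -/
theorem newton_sub_newton {a : ℕ → ℝ} (ha : LogBounded a) {y : ℝ} (hy : 0 < y) :
    newton a y - newton a (y - 1) = newtonDiff a y := by
  have h1 := ha.summable_signedBinom_succ (by linarith : -1 < y)
  have h2 := ha.summable_signedBinom_succ (by linarith : -1 < y - 1)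
  rw [newton, newton, newtonDiff, sub_neg_eq_add, neg_add_eq_sub, ← h2.tsum_sub h1]
  refine tsum_congr fun n => ?_
  have := signedBinom_sub_one_sub n y
  linear_combination -a n * this

/-- The absorption identity, applied term by term. -/
theorem mul_newtonDiff_of_succ_mul {a b : ℕ → ℝ} (h : ∀ n : ℕ, ((n : ℝ) + 1) * b n = a n) (y : ℝ) :
    y * newtonDiff b y = newton a y := by
  rw [newton, newtonDiff, ← tsum_mul_left, ← tsum_neg]
  refine tsum_congr fun n => ?_
  rw [← h]
  linear_combination b n * succ_mul_signedBinom_succ n y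

/-- Summation by parts: `key` is the identity of partial sums, whose boundary term is a power of the
logarithm times `M^{-y}` and hence vanishes in the limit. -/
theorem mul_newtonDiff_of_average {a b : ℕ → ℝ} (ha : LogBounded a) (hb : LogBounded b)
    (h : ∀ n : ℕ, ((n : ℝ) + 1) * b n = ∑ i ∈ Finset.range (n + 1), a i) {y : ℝ} (hy : 0 < y) :
    y * newtonDiff b y = newtonDiff a y := by
  have hy1 : -1 < y - 1 := by linarith
  have key : ∀ M : ℕ, ∑ n ∈ Finset.range (M + 1), y * (signedBinom n (y - 1) * b n) =
      ∑ n ∈ Finset.range (M + 1), signedBinom n (y - 1) * a n -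
        signedBinom (M + 1) (y - 1) * (((M : ℝ) + 1) * b M) := by
    intro M
    induction M with
    | zero =>
      have h0 := h 0
      simp at h0
      simp [signedBinom, h0]
      ring
    | succ M ih =>
      rw [Finset.sum_range_succ, ih, Finset.sum_range_succ _ (M + 1)]
      have hM := h (M + 1)
      rw [Finset.sum_range_succ, ← h M] at hM
      have e1 := succ_mul_signedBinom_succ (M + 1) y
      have e2 := signedBinom_sub_one_sub (M + 1) y
      push_cast at hM e1 ⊢
      linear_combination signedBinom (M + 1) (y - 1) * hM + b (M + 1) * e1 -
        ((M : ℝ) + 1 + 1) * b (M + 1) * e2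
  have hlim : Tendsto (fun M : ℕ => signedBinom (M + 1) (y - 1) * (((M : ℝ) + 1) * b M))
      atTop (nhds 0) := by
    obtain ⟨C, hC0, hC⟩ := exists_abs_signedBinom_le hy1
    obtain ⟨q, hq⟩ := hb
    obtain ⟨D, hD, hlog⟩ := exists_one_add_log_pow_le q (half_pos hy)
    have ht : Tendsto (fun M : ℕ => C * D * ((M : ℝ) + 1) ^ (-(y / 2))) atTop (nhds 0) := by
      have := (tendsto_rpow_neg_atTop (half_pos hy)).comp
        (tendsto_atTop_add_const_right atTop (1 : ℝ) tendsto_natCast_atTop_atTop)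
      simpa using this.const_mul (C * D)
    refine squeeze_zero_norm (fun M => ?_) ht
    have h1 : (0 : ℝ) < (M : ℝ) + 1 := by positivity
    have hl := hlog ((M : ℝ) + 1) (by linarith [M.cast_nonneg (α := ℝ)])
    have hbM : |((M : ℝ) + 1) * b M| ≤ D * ((M : ℝ) + 1) ^ (y / 2) := by
      rw [abs_mul, abs_of_pos h1]
      have := hq M
      rw [le_div_iff₀ h1] at this
      linarith
    have hCM : |signedBinom (M + 1) (y - 1)| ≤ C * ((M : ℝ) + 1) ^ (-y) := by
      refine (hC (M + 1)).trans ?_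
      gcongr C * ?_
      push_cast
      rw [add_sub_cancel]
      exact Real.rpow_le_rpow_of_nonpos (by positivity) (by linarith) (by linarith)
    rw [Real.norm_eq_abs, abs_mul]
    calc _ ≤ (C * ((M : ℝ) + 1) ^ (-y)) * (D * ((M : ℝ) + 1) ^ (y / 2)) :=
          mul_le_mul hCM hbM (abs_nonneg _) (by positivity)
      _ = _ := by
          rw [show -(y / 2) = -y + y / 2 by ring, Real.rpow_add h1]
          ring
  have h1 := ((hb.summable_signedBinom hy1).mul_left y).hasSum.tendsto_sum_nat.comp
    (tendsto_add_atTop_nat 1)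
  have h2 := ((ha.summable_signedBinom hy1).hasSum.tendsto_sum_nat.comp
    (tendsto_add_atTop_nat 1)).sub hlim
  rw [newtonDiff, newtonDiff, ← tsum_mul_left]
  refine tendsto_nhds_unique h1 ?_
  rw [sub_zero] at h2
  refine h2.congr fun M => ?_
  simp only [Function.comp_apply]
  exact (key M).symm

/-! ### Totally monotone sequences -/

/-- Iterated backward differences: `bdiff a (N + 1) p = bdiff a N p - bdiff a N (p + 1)`. -/
def bdiff (a : ℕ → ℝ) : ℕ → ℕ → ℝ
  | 0 => a
  | N + 1 => fun p => bdiff a N p - bdiff a N (p + 1)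

/-- A totally monotone sequence. -/
def TotallyMonotone (a : ℕ → ℝ) : Prop := ∀ N p, 0 ≤ bdiff a N p

theorem bdiff_succ (a : ℕ → ℝ) (N p : ℕ) :
    bdiff a (N + 1) p = bdiff a N p - bdiff a N (p + 1) := rfl

theorem TotallyMonotone.antitone {a : ℕ → ℝ} (ha : TotallyMonotone a) (N : ℕ) :
    Antitone (bdiff a N) :=
  antitone_nat_of_succ_le fun p => sub_nonneg.mp (ha (N + 1) p)

theorem TotallyMonotone.bdiff_le {a : ℕ → ℝ} (ha : TotallyMonotone a) (N p : ℕ) :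
    bdiff a N p ≤ a p := by
  induction N with
  | zero => exact le_rfl
  | succ N ih =>
    rw [bdiff_succ]
    linarith [ha N (p + 1)]

theorem totallyMonotone_one : TotallyMonotone fun _ => 1 := by
  have : ∀ N p, bdiff (fun _ => 1) (N + 1) p = 0 := by
    intro N
    induction N with
    | zero => intro p; simp [bdiff]
    | succ N ih => intro p; rw [bdiff_succ, ih, ih, sub_self]
  intro N p
  cases N with
  | zero => simp [bdiff]
  | succ N => rw [this]

/-- `key` is Leibniz's rule for iterated differences of `(n + 1) b n`; it expresses `bdiff b N` with
nonnegative coefficients through `bdiff a N` and `bdiff b (N - 1)`, so induction on `N` applies. The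
truncated `N - 1` at `N = 0` has coefficient zero. -/
theorem TotallyMonotone.of_succ_mul {a b : ℕ → ℝ} (ha : TotallyMonotone a)
    (h : ∀ n : ℕ, ((n : ℝ) + 1) * b n = a n) : TotallyMonotone b := by
  have key : ∀ N p : ℕ, bdiff a N p =
      ((p : ℝ) + 1 + N) * bdiff b N p - N * bdiff b (N - 1) p := by
    intro N
    induction N with
    | zero => intro p; simp [bdiff, h]
    | succ N ih =>
      intro p
      rw [bdiff_succ, ih, ih, Nat.add_sub_cancel, bdiff_succ b]
      cases N with
      | zero => push_cast; ring
      | succ N =>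
        simp only [Nat.add_sub_cancel]
        rw [bdiff_succ b N p, bdiff_succ b N (p + 1)]
        push_cast
        ring
  intro N
  induction N with
  | zero =>
    intro p
    have h1 := ha 0 p
    have h2 := h p
    simp only [bdiff] at h1 ⊢
    rw [← h2] at h1
    exact nonneg_of_mul_nonneg_right h1 (by positivity)
  | succ N ih =>
    intro p
    have h1 := ha (N + 1) p
    rw [key, Nat.add_sub_cancel] at h1
    have h2 := ih p
    refine nonneg_of_mul_nonneg_right (?_ : 0 ≤ ((p : ℝ) + 1 + (N + 1 : ℕ)) * _) (by positivity)
    have : 0 ≤ ((N + 1 : ℕ) : ℝ) * bdiff b N p := by positivity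
    linarith

/-- Leibniz's rule again, now for `a p = (p + 1) b p - p b (p - 1)`; positivity propagates in `p`
instead of in `N`. -/
theorem TotallyMonotone.of_average {a b : ℕ → ℝ} (ha : TotallyMonotone a)
    (h : ∀ n : ℕ, ((n : ℝ) + 1) * b n = ∑ i ∈ Finset.range (n + 1), a i) : TotallyMonotone b := by
  have key : ∀ N p : ℕ, bdiff a N p =
      ((p : ℝ) + 1 + N) * bdiff b N p - p * bdiff b N (p - 1) := by
    intro N
    induction N with
    | zero =>
      intro p
      cases p with
      | zero => simpa [bdiff] using (h 0).symm
      | succ p =>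
        have h1 := h (p + 1)
        rw [Finset.sum_range_succ, ← h p] at h1
        simp only [bdiff, Nat.add_sub_cancel]
        push_cast at h1 ⊢
        linear_combination -h1
    | succ N ih =>
      intro p
      rw [bdiff_succ, ih, ih, Nat.add_sub_cancel, bdiff_succ b]
      cases p with
      | zero => push_cast; ring
      | succ p =>
        simp only [Nat.add_sub_cancel]
        rw [bdiff_succ b N p]
        push_cast
        ring
  intro N p
  induction p with
  | zero =>
    have h1 := ha N 0
    rw [key] at h1
    simp only [CharP.cast_eq_zero, zero_mul, sub_zero] at h1
    exact nonneg_of_mul_nonneg_right h1 (by positivity)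
  | succ p ih =>
    have h1 := ha N (p + 1)
    rw [key, Nat.add_sub_cancel] at h1
    refine nonneg_of_mul_nonneg_right (?_ : 0 ≤ (((p + 1 : ℕ) : ℝ) + 1 + N) * _) (by positivity)
    have : 0 ≤ ((p + 1 : ℕ) : ℝ) * bdiff b N p := by positivity
    linarith

theorem TotallyMonotone.logBounded_bdiff {a : ℕ → ℝ} (hm : TotallyMonotone a) (ha : LogBounded a)
    (N : ℕ) : LogBounded (bdiff a N) :=
  ha.mono fun n => by
    rw [abs_of_nonneg (hm N n)]
    exact (hm.bdiff_le N n).trans (le_abs_self _)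

/-- Shifting the argument by one differences the coefficients. Iteration exposes `bdiff a N` in the
value at `y + N`, where total monotonicity can act. -/
theorem newton_add_one {a : ℕ → ℝ} (ha : LogBounded a) {y : ℝ} (hy : -1 < y) :
    newton a (y + 1) = a 0 + newton (fun p => a p - a (p + 1)) y := by
  have h := newton_sub_newton ha (by linarith : 0 < y + 1)
  have h1 := ha.summable_signedBinom hy
  have h2 := ha.summable_signedBinom_succ hy
  have h3 := (summable_nat_add_iff 1).mpr h1
  rw [add_sub_cancel_right, newtonDiff, add_sub_cancel_right, h1.tsum_eq_zero_add,
    signedBinom_zero, one_mul] at h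
  have e : newton (fun p => a p - a (p + 1)) y =
      newton a y + ∑' n, signedBinom (n + 1) y * a (n + 1) := by
    rw [newton, newton, neg_add_eq_sub, ← h3.tsum_sub h2, ← tsum_neg]
    exact tsum_congr fun n => by ring
  rw [e]
  linarith

theorem newton_add_natCast {a : ℕ → ℝ} (hm : TotallyMonotone a) (ha : LogBounded a) {y : ℝ}
    (hy : -1 < y) (N : ℕ) :
    newton a (y + N) = ∑ i ∈ Finset.range N, bdiff a i 0 + newton (bdiff a N) y := by
  suffices H : ∀ M : ℕ, newton (bdiff a M) (y + N) =
      ∑ i ∈ Finset.range N, bdiff a (M + i) 0 + newton (bdiff a (M + N)) y by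
    simpa [bdiff] using H 0
  induction N with
  | zero => simp
  | succ N ih =>
    intro M
    rw [Nat.cast_succ, ← add_assoc, newton_add_one (hm.logBounded_bdiff ha M)
      (by linarith [N.cast_nonneg (α := ℝ)])]
    have := ih (M + 1)
    simp only [bdiff] at this
    rw [this, Finset.sum_range_succ']
    simp only [add_zero, add_assoc, add_comm 1]
    rw [add_comm]
    simp only [add_assoc]
    rw [add_comm (newton _ y)]

theorem newton_natCast_add_one_sub {a : ℕ → ℝ} (hm : TotallyMonotone a) (ha : LogBounded a)
    (N : ℕ) : newton a (N + 1) - newton a N = bdiff a N 0 := by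
  have h0 := newton_add_natCast hm ha (by norm_num : (-1 : ℝ) < 0) N
  have h1 := newton_add_natCast hm ha (by norm_num : (-1 : ℝ) < 0) (N + 1)
  simp only [zero_add, newton_zero, add_zero, Finset.sum_range_succ] at h0 h1
  push_cast at h1
  rw [h0, h1]
  ring

/-- Shifting the argument of a Newton series by a bounded amount changes its value at `N + 1` by
at most a constant times its increment there. -/
theorem exists_abs_newton_add_sub_le {a : ℕ → ℝ} (hm : TotallyMonotone a) (ha : LogBounded a)
    {x : ℝ} (hx : -1 < x) :
    ∃ C, ∀ N : ℕ, |newton a (x + (N + 1 : ℕ)) - newton a (N + 1 : ℕ)| ≤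
      C * (newton a (N + 1 : ℕ) - newton a N) := by
  have hx1 : 0 < x + 1 := by linarith
  -- Writing `x + (N + 1)` as `(x + 1) + N` makes the base point positive, so the binomial
  -- coefficients are absolutely summable.
  have hs : Summable fun n => |signedBinom (n + 1) (x + 1)| := by
    obtain ⟨D, _, hD⟩ := exists_abs_signedBinom_le (by linarith : -1 < x + 1)
    have := (Real.summable_nat_rpow (p := -(1 + (x + 1)))).mpr (by linarith)
    have h2 := ((summable_nat_add_iff 2).mpr this).mul_left D
    refine Summable.of_nonneg_of_le (fun n => abs_nonneg _) (fun n => ?_) h2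
    convert hD (n + 1) using 3
    push_cast
    ring
  refine ⟨∑' n, |signedBinom (n + 1) (x + 1)| + 1, fun N => ?_⟩
  have h0 := newton_add_natCast hm ha (by norm_num : (-1 : ℝ) < 0) N
  have h1 := newton_add_natCast hm ha (by linarith : -1 < x + 1) N
  have h2 := newton_natCast_add_one_sub hm ha N
  simp only [zero_add, newton_zero, add_zero] at h0
  rw [← h0] at h1
  -- Total monotonicity bounds every `bdiff a N n` by `bdiff a N 0`, which is the increment of the
  -- Newton series from `N` to `N + 1`.
  have h3 : |newton (bdiff a N) (x + 1)| ≤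
      (∑' n, |signedBinom (n + 1) (x + 1)|) * bdiff a N 0 := by
    have hle : ∀ n, ‖signedBinom (n + 1) (x + 1) * bdiff a N n‖ ≤
        |signedBinom (n + 1) (x + 1)| * bdiff a N 0 := by
      intro n
      rw [Real.norm_eq_abs, abs_mul, abs_of_nonneg (hm N n)]
      gcongr
      exact hm.antitone N (Nat.zero_le n)
    rw [newton, abs_neg, ← Real.norm_eq_abs, ← tsum_mul_right]
    exact tsum_of_norm_bounded (hs.mul_right _).hasSum hle
  push_cast
  rw [show x + ((N : ℝ) + 1) = x + 1 + N by ring, h1, h2]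
  have : newton a N + newton (bdiff a N) (x + 1) - newton a (N + 1) =
      newton (bdiff a N) (x + 1) - bdiff a N 0 := by linarith
  rw [this]
  calc _ ≤ |newton (bdiff a N) (x + 1)| + |bdiff a N 0| := abs_sub _ _
    _ ≤ _ := by
      rw [abs_of_nonneg (hm N 0)]
      linarith

/-! ### The Newton series of the Kawashima function -/

theorem starSum_concat_eq_sum (v : Index) (c : ℕ+) (n : ℕ) :
    starSum (v ++ [c]) n =
      ∑ i ∈ Finset.range n, (1 / ((i : ℝ) + 1)) ^ (c : ℕ) * starSum v (i + 1) := by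
  induction n with
  | zero => rw [starSum_zero (by simp), Finset.sum_range_zero]
  | succ n ih => rw [starSum_concat_succ, ih, Finset.sum_range_succ]

theorem one_div_succ_pow_le (n : ℕ) (c : ℕ+) :
    (1 / ((n : ℝ) + 1)) ^ (c : ℕ) ≤ 1 / ((n : ℝ) + 1) := by
  refine pow_le_of_le_one (by positivity) ?_ c.pos.ne'
  rw [div_le_one (by positivity)]
  linarith [n.cast_nonneg (α := ℝ)]

theorem starSum_le (v : Index) (n : ℕ) : starSum v n ≤ (1 + Real.log n) ^ v.length := by
  induction v using List.reverseRecOn generalizing n with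
  | nil => simp
  | append_singleton v c ih =>
    have h0 : 0 ≤ Real.log n := Real.log_natCast_nonneg n
    rw [starSum_concat_eq_sum, List.length_append, List.length_singleton, pow_succ']
    calc _ ≤ ∑ i ∈ Finset.range n, 1 / ((i : ℝ) + 1) * (1 + Real.log n) ^ v.length := by
          refine Finset.sum_le_sum fun i hi => ?_
          have hin : i + 1 ≤ n := Finset.mem_range.mp hi
          refine mul_le_mul (one_div_succ_pow_le i c) ((ih (i + 1)).trans ?_)
            (starSum_nonneg _ _) (by positivity)
          have := Real.log_natCast_nonneg (i + 1)
          gcongr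
      _ ≤ _ := by
          rw [← Finset.sum_mul]
          gcongr
          have := harmonic_le_one_add_log n
          simp only [harmonic] at this
          push_cast at this
          simpa only [one_div] using this

/-- The coefficients of the Newton series of the Kawashima function. -/
def kawashimaCoeff (k : Index) (n : ℕ) : ℝ :=
  starSum (hoffmanDual k) (n + 1) - starSum (hoffmanDual k) n

theorem kawashimaCoeff_eq {k v : Index} {c : ℕ+} (h : hoffmanDual k = v ++ [c]) (n : ℕ) :
    kawashimaCoeff k n = (1 / ((n : ℝ) + 1)) ^ (c : ℕ) * starSum v (n + 1) := by
  rw [kawashimaCoeff, h, starSum_concat_succ, add_sub_cancel_left]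

theorem exists_hoffmanDual_eq_concat {k : Index} (hk : k ≠ []) :
    ∃ v c, hoffmanDual k = v ++ [c] :=
  (List.eq_nil_or_concat' _).resolve_left (hoffmanDual_ne_nil hk)

theorem kawashimaCoeff_nonneg {k : Index} (hk : k ≠ []) (n : ℕ) : 0 ≤ kawashimaCoeff k n := by
  obtain ⟨v, c, h⟩ := exists_hoffmanDual_eq_concat hk
  rw [kawashimaCoeff_eq h]
  have := starSum_nonneg v (n + 1)
  positivity

theorem logBounded_kawashimaCoeff {k : Index} (hk : k ≠ []) : LogBounded (kawashimaCoeff k) := by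
  obtain ⟨v, c, h⟩ := exists_hoffmanDual_eq_concat hk
  refine ⟨v.length, fun n => ?_⟩
  rw [abs_of_nonneg (kawashimaCoeff_nonneg hk n), kawashimaCoeff_eq h,
    ← one_div_mul_eq_div ((n : ℝ) + 1) ((1 + Real.log ((n : ℝ) + 1)) ^ v.length)]
  refine mul_le_mul (one_div_succ_pow_le n c) ?_ (starSum_nonneg _ _) (by positivity)
  exact_mod_cast starSum_le v (n + 1)

theorem kawashimaCoeff_singleton_one (n : ℕ) : kawashimaCoeff [1] n = 1 / ((n : ℝ) + 1) := by
  rw [kawashimaCoeff_eq (v := []) (c := 1) hoffmanDual_singleton_one]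
  simp

theorem succ_mul_kawashimaCoeff_concat_one {k : Index} (hk : k ≠ []) (n : ℕ) :
    ((n : ℝ) + 1) * kawashimaCoeff (k ++ [1]) n = kawashimaCoeff k n := by
  obtain ⟨v, c, h⟩ := exists_hoffmanDual_eq_concat hk
  have h' : hoffmanDual (k ++ [1]) = v ++ [1 + c] := by
    rw [hoffmanDual_concat_one hk, h, addLast_concat]
  rw [kawashimaCoeff_eq h, kawashimaCoeff_eq h', PNat.add_coe, pow_add]
  simp only [PNat.one_coe, pow_one]
  field_simp

/-- The dual acquires a final entry `1`, so the coefficient is `1 / (n + 1)` times a star sum of the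
old dual, which is the telescoped sum of the old coefficients. -/
theorem succ_mul_kawashimaCoeff_concat_one_add (k : Index) (c : ℕ+) (n : ℕ) :
    ((n : ℝ) + 1) * kawashimaCoeff (k ++ [1 + c]) n =
      ∑ i ∈ Finset.range (n + 1), kawashimaCoeff (k ++ [c]) i := by
  rw [kawashimaCoeff_eq (hoffmanDual_concat_one_add k c)]
  simp only [kawashimaCoeff, Finset.sum_range_sub (fun i => starSum (hoffmanDual (k ++ [c])) i)]
  rw [starSum_zero (hoffmanDual_ne_nil (by simp)), sub_zero]
  simp only [PNat.one_coe, pow_one]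
  field_simp

theorem totallyMonotone_kawashimaCoeff (k : Index) (hk : k ≠ []) :
    TotallyMonotone (kawashimaCoeff k) := by
  induction k using List.reverseRecOn with
  | nil => exact absurd rfl hk
  | append_singleton k c ih =>
    induction c with
    | one =>
      by_cases h : k = []
      · subst h
        refine totallyMonotone_one.of_succ_mul fun n => ?_
        rw [List.nil_append, kawashimaCoeff_singleton_one]
        field_simp
      · exact (ih h).of_succ_mul (succ_mul_kawashimaCoeff_concat_one h)
    | succ c ihc =>
      rw [add_comm c 1]
      exact (ihc (by simp)).of_average (succ_mul_kawashimaCoeff_concat_one_add k c)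

/-- The Kawashima function as a Newton series. -/
def kawashimaNewton (k : Index) (y : ℝ) : ℝ := if k = [] then 1 else newton (kawashimaCoeff k) y

@[simp] theorem kawashimaNewton_nil (y : ℝ) : kawashimaNewton [] y = 1 := if_pos rfl

theorem kawashimaNewton_of_ne_nil {k : Index} (hk : k ≠ []) (y : ℝ) :
    kawashimaNewton k y = newton (kawashimaCoeff k) y := if_neg hk

theorem pow_mul_newtonDiff_kawashimaCoeff (k : Index) (c : ℕ+) {y : ℝ} (hy : 0 < y) :
    y ^ (c : ℕ) * newtonDiff (kawashimaCoeff (k ++ [c])) y = kawashimaNewton k y := by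
  induction c with
  | one =>
    simp only [PNat.one_coe, pow_one]
    by_cases h : k = []
    · subst h
      -- The coefficients `1 / (n + 1)` of `[1]` are the averages of the unit sequence at `0`, whose
      -- differenced Newton series is `1 = F(∅)`.
      have hδ : LogBounded fun n => if n = 0 then (1 : ℝ) else 0 := by
        refine ⟨0, fun n => ?_⟩
        by_cases hn : n = 0
        · simp [hn]
        · simp only [hn, if_false, abs_zero]
          positivity
      rw [mul_newtonDiff_of_average hδ (logBounded_kawashimaCoeff (by simp)) _ hy]
      · rw [newtonDiff, tsum_eq_single 0 (by intro n hn; simp [hn])]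
        simp
      · intro n
        rw [List.nil_append, kawashimaCoeff_singleton_one]
        simp only [Finset.sum_ite_eq', Finset.mem_range, Nat.succ_pos, if_true]
        field_simp
    · rw [mul_newtonDiff_of_succ_mul (succ_mul_kawashimaCoeff_concat_one h),
        kawashimaNewton_of_ne_nil h]
  | succ c ih =>
    rw [add_comm c 1, PNat.add_coe, add_comm, PNat.one_coe, pow_succ, mul_assoc,
      mul_newtonDiff_of_average (logBounded_kawashimaCoeff (by simp))
        (logBounded_kawashimaCoeff (by simp)) (succ_mul_kawashimaCoeff_concat_one_add k c) hy, ih]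

/-- The difference equation of the Kawashima function. -/
theorem kawashimaNewton_concat (k : Index) (c : ℕ+) {y : ℝ} (hy : 0 < y) :
    kawashimaNewton (k ++ [c]) y =
      kawashimaNewton (k ++ [c]) (y - 1) + (1 / y) ^ (c : ℕ) * kawashimaNewton k y := by
  have h := newton_sub_newton (logBounded_kawashimaCoeff (k := k ++ [c]) (by simp)) hy
  rw [kawashimaNewton_of_ne_nil (by simp), kawashimaNewton_of_ne_nil (by simp),
    ← pow_mul_newtonDiff_kawashimaCoeff k c hy, ← mul_assoc, ← mul_pow,
    one_div_mul_cancel hy.ne', one_pow, one_mul]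
  linarith

/-- Both sides satisfy the same recursion in `n` and, for non-empty `k`, vanish at `0`. Note that
`k` itself appears here, while the coefficients involve its dual. -/
theorem kawashimaNewton_natCast (k : Index) (n : ℕ) : kawashimaNewton k n = starSum k n := by
  induction k using List.reverseRecOn generalizing n with
  | nil => simp
  | append_singleton k c ih =>
    induction n with
    | zero =>
      rw [starSum_zero (by simp), kawashimaNewton_of_ne_nil (by simp), Nat.cast_zero, newton_zero]
    | succ n ihn =>
      rw [kawashimaNewton_concat k c (by positivity), ih, starSum_concat_succ, ← ihn]
      push_cast
      rw [add_sub_cancel_right]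

theorem exists_abs_kawashimaNewton_sub_starSum_le (k : Index) {x : ℝ} (hx : -1 < x) :
    ∃ C, ∀ N : ℕ, |kawashimaNewton k (x + (N + 1 : ℕ)) - starSum k (N + 1)| ≤
      C * (starSum k (N + 1) - starSum k N) := by
  by_cases hk : k = []
  · subst hk
    exact ⟨0, fun N => by simp⟩
  · obtain ⟨C, hC⟩ := exists_abs_newton_add_sub_le (totallyMonotone_kawashimaCoeff k hk)
      (logBounded_kawashimaCoeff hk) hx
    refine ⟨C, fun N => ?_⟩
    have := hC N
    simp only [← kawashimaNewton_of_ne_nil hk, kawashimaNewton_natCast] at this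
    exact this

/-- Passing from `N` to `N + 1`, the change of `F` in term `j + 1` cancels the change of the Hurwitz
sum in term `j`. At `N = 0` only `j = r` survives. -/
theorem kawashimaNewton_eq_sum (k : Index) {x : ℝ} (hx : -1 < x) (N : ℕ) :
    kawashimaNewton k x = ∑ j ∈ Finset.range (k.length + 1), (-1) ^ (k.length - j) *
      kawashimaNewton (k.take j) (x + N) * hurwitzSum x (k.drop j).reverse (N + 1) := by
  induction N with
  | zero =>
    rw [Finset.sum_range_succ, Finset.sum_eq_zero]
    · simp
    · intro j hj
      rw [zero_add, hurwitzSum_one_of_ne_nil, mul_zero]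
      have := Finset.mem_range.mp hj
      simpa using this
  | succ N ih =>
    have hpos : 0 < x + (N + 1 : ℕ) := by
      push_cast
      linarith [N.cast_nonneg (α := ℝ)]
    rw [ih, ← sub_eq_zero, ← Finset.sum_sub_distrib]
    have hA : ∀ j (hj : j < k.length), kawashimaNewton (k.take (j + 1)) (x + (N + 1 : ℕ)) =
        kawashimaNewton (k.take (j + 1)) (x + N) + (1 / (x + (N + 1 : ℕ))) ^ (k[j] : ℕ) *
          kawashimaNewton (k.take j) (x + (N + 1 : ℕ)) := by
      intro j hj
      rw [← List.take_concat_get' k j hj, kawashimaNewton_concat _ _ hpos]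
      push_cast
      rw [← add_assoc, add_sub_cancel_right]
    have hB : ∀ j (hj : j < k.length), hurwitzSum x (k.drop j).reverse (N + 2) =
        hurwitzSum x (k.drop j).reverse (N + 1) + (1 / (x + (N + 1 : ℕ))) ^ (k[j] : ℕ) *
          hurwitzSum x (k.drop (j + 1)).reverse (N + 1) := by
      intro j hj
      rw [List.drop_eq_getElem_cons hj, List.reverse_cons, hurwitzSum_concat, add_comm x]
    set r := k.length
    have e : ∀ j ∈ Finset.range (r + 1),
        (-1) ^ (r - j) * kawashimaNewton (k.take j) (x + N) *
            hurwitzSum x (k.drop j).reverse (N + 1) -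
          (-1) ^ (r - j) * kawashimaNewton (k.take j) (x + (N + 1 : ℕ)) *
            hurwitzSum x (k.drop j).reverse (N + 1 + 1) =
        (-1) ^ (r - j) * (kawashimaNewton (k.take j) (x + N) -
            kawashimaNewton (k.take j) (x + (N + 1 : ℕ))) *
            hurwitzSum x (k.drop j).reverse (N + 1) -
          (-1) ^ (r - j) * kawashimaNewton (k.take j) (x + (N + 1 : ℕ)) *
            (hurwitzSum x (k.drop j).reverse (N + 2) -
              hurwitzSum x (k.drop j).reverse (N + 1)) := fun j _ => by ring
    rw [Finset.sum_congr rfl e, Finset.sum_sub_distrib, Finset.sum_range_succ',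
      Finset.sum_range_succ (fun j => (-1) ^ (r - j) *
        kawashimaNewton (k.take j) (x + (N + 1 : ℕ)) * (hurwitzSum x (k.drop j).reverse (N + 2) -
              hurwitzSum x (k.drop j).reverse (N + 1)))]
    have z1 : k.drop r = [] := by simp [r]
    simp only [List.take_zero, kawashimaNewton_nil, sub_self, mul_zero, zero_mul, add_zero, z1,
      List.reverse_nil, hurwitzSum_nil, ← Finset.sum_sub_distrib]
    refine Finset.sum_eq_zero fun j hj => ?_
    have hj' := Finset.mem_range.mp hj
    rw [hA j hj', hB j hj', show r - j = (r - (j + 1)) + 1 by omega, pow_succ]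
    ring

/-! ### Sequences of order `N^{-s}` up to powers of the logarithm -/

/-- `f N = O(N^{-s} log^p N)` for some `p`. -/
def LogO (s : ℕ) (f : ℕ → ℝ) : Prop :=
  ∃ p : ℕ, f =O[atTop] fun N : ℕ => (N : ℝ)⁻¹ ^ s * Real.log N ^ p

theorem eventually_one_le_log : ∀ᶠ N : ℕ in atTop, 1 ≤ Real.log N :=
  (Real.tendsto_log_atTop.comp tendsto_natCast_atTop_atTop).eventually_ge_atTop 1

theorem isBigO_inv_pow_mul_log_pow {s t p q : ℕ} (hs : t ≤ s) (hp : p ≤ q) :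
    (fun N : ℕ => (N : ℝ)⁻¹ ^ s * Real.log N ^ p) =O[atTop]
      fun N : ℕ => (N : ℝ)⁻¹ ^ t * Real.log N ^ q := by
  refine IsBigO.of_bound 1 ?_
  filter_upwards [eventually_one_le_log, eventually_ge_atTop 1] with N hN h1
  have h2 : (N : ℝ)⁻¹ ≤ 1 := inv_le_one_of_one_le₀ (by exact_mod_cast h1)
  have h0 : 0 ≤ Real.log N := zero_le_one.trans hN
  rw [one_mul, Real.norm_of_nonneg (by positivity), Real.norm_of_nonneg (by positivity)]
  exact mul_le_mul (pow_le_pow_of_le_one (by positivity) h2 hs) (pow_le_pow_right₀ hN hp)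
    (by positivity) (by positivity)

namespace LogO

variable {s t : ℕ} {f g : ℕ → ℝ}

theorem mono (hf : LogO s f) (h : t ≤ s) : LogO t f := by
  obtain ⟨p, hp⟩ := hf
  exact ⟨p, hp.trans (isBigO_inv_pow_mul_log_pow h le_rfl)⟩

theorem add (hf : LogO s f) (hg : LogO s g) : LogO s fun N => f N + g N := by
  obtain ⟨p, hp⟩ := hf
  obtain ⟨q, hq⟩ := hg
  exact ⟨max p q, (hp.trans (isBigO_inv_pow_mul_log_pow le_rfl (le_max_left p q))).add
    (hq.trans (isBigO_inv_pow_mul_log_pow le_rfl (le_max_right p q)))⟩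

theorem mul (hf : LogO s f) (hg : LogO t g) : LogO (s + t) fun N => f N * g N := by
  obtain ⟨p, hp⟩ := hf
  obtain ⟨q, hq⟩ := hg
  refine ⟨p + q, (hp.mul hq).congr_right fun N => ?_⟩
  rw [pow_add, pow_add]
  ring

theorem of_isBigO (hg : LogO s g) (h : f =O[atTop] g) : LogO s f := by
  obtain ⟨p, hp⟩ := hg
  exact ⟨p, h.trans hp⟩

theorem congr' (hf : LogO s f) (h : f =ᶠ[atTop] g) : LogO s g :=
  hf.of_isBigO h.symm.isBigO

theorem of_bound (C : ℝ) (hg : LogO s g) (h : ∀ᶠ N : ℕ in atTop, |f N| ≤ C * |g N|) : LogO s f :=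
  hg.of_isBigO (IsBigO.of_bound C h)

theorem const (c : ℝ) : LogO 0 fun _ => c :=
  ⟨0, by simpa using isBigO_const_const c (one_ne_zero (α := ℝ)) (atTop : Filter ℕ)⟩

theorem log : LogO 0 fun N => Real.log N := ⟨1, by simpa using isBigO_refl _ _⟩

theorem inv : LogO 1 fun N => (N : ℝ)⁻¹ := ⟨0, by simpa using isBigO_refl _ _⟩

theorem zero (s : ℕ) : LogO s fun _ => 0 := ⟨0, isBigO_zero _ _⟩

theorem const_mul (c : ℝ) (hf : LogO s f) : LogO s fun N => c * f N := by
  simpa using (const c).mul hf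

theorem neg (hf : LogO s f) : LogO s fun N => -f N := by
  simpa using hf.const_mul (-1)

theorem sub (hf : LogO s f) (hg : LogO s g) : LogO s fun N => f N - g N := by
  simpa [sub_eq_add_neg] using hf.add hg.neg

theorem pow (hf : LogO s f) (n : ℕ) : LogO (s * n) fun N => f N ^ n := by
  induction n with
  | zero => simpa using const 1
  | succ n ih => simpa [pow_succ, mul_add] using ih.mul hf

theorem sum {ι : Type*} (S : Finset ι) {F : ι → ℕ → ℝ} (h : ∀ i ∈ S, LogO s (F i)) :
    LogO s fun N => ∑ i ∈ S, F i N := by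
  classical
  induction S using Finset.induction_on with
  | empty => simpa using zero s
  | insert i S hi ih =>
    simp only [Finset.sum_insert hi]
    exact (h i (Finset.mem_insert_self i S)).add
      (ih fun j hj => h j (Finset.mem_insert_of_mem hj))

theorem multiset_sum {ι : Type*} (S : Multiset ι) {F : ι → ℕ → ℝ} (h : ∀ i ∈ S, LogO s (F i)) :
    LogO s fun N => (S.map fun i => F i N).sum := by
  induction S using Multiset.induction_on with
  | empty => simpa using zero s
  | cons i S ih =>
    simp only [Multiset.map_cons, Multiset.sum_cons]
    exact (h i (Multiset.mem_cons_self i S)).add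
      (ih fun j hj => h j (Multiset.mem_cons_of_mem hj))

theorem eval (P : ℝ[X]) (hf : LogO 0 f) : LogO 0 fun N => P.eval (f N) := by
  simp only [eval_eq_sum_range]
  refine sum _ fun i _ => ?_
  have := (hf.pow i).const_mul (P.coeff i)
  rwa [zero_mul] at this

theorem tendsto_zero (hf : LogO 1 f) : Tendsto f atTop (nhds 0) := by
  obtain ⟨p, hp⟩ := hf
  refine hp.trans_tendsto ?_
  have h := (Real.isLittleO_pow_log_id_atTop (n := p)).tendsto_div_nhds_zero.comp
    (tendsto_natCast_atTop_atTop (R := ℝ))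
  refine h.congr fun N => ?_
  simp [div_eq_inv_mul]

end LogO

/-- A telescoping majorant of `m^{-3/2}` for tail sums. The constant arises from `√(m + 1) ≤ 2 √m`,
which gives `b (a + b) ≤ 2a · 3a`. -/
theorem inv_sqrt_pow_three_le {m : ℝ} (hm : 1 ≤ m) :
    √m / m ^ 2 ≤ 6 * (1 / √m - 1 / √(m + 1)) := by
  have hs : 0 < √m := Real.sqrt_pos.mpr (by linarith)
  have ht : 0 < √(m + 1) := Real.sqrt_pos.mpr (by linarith)
  have hs2 : √m ^ 2 = m := Real.sq_sqrt (by linarith)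
  have ht2 : √(m + 1) ^ 2 = m + 1 := Real.sq_sqrt (by linarith)
  have hst : √(m + 1) ≤ 2 * √m := by
    refine abs_le_of_sq_le_sq' ?_ (by positivity) |>.2
    rw [mul_pow, hs2, ht2]; linarith
  generalize √m = a at *
  generalize √(m + 1) = b at *
  subst hs2
  have e : 1 / a - 1 / b = 1 / (a * b * (a + b)) := by
    field_simp
    linear_combination ht2
  rw [e, mul_one_div, div_le_div_iff₀ (by positivity) (by positivity)]
  have : b * (a + b) ≤ 2 * a * (3 * a) := by
    refine mul_le_mul hst (by linarith) (by positivity) (by positivity)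
  nlinarith [mul_le_mul_of_nonneg_left this (by positivity : 0 ≤ a ^ 2)]

/-- The partial sums of a series of order `N^{-2}` converge at the rate `N^{-1}`, up to powers of
the logarithm. -/
theorem LogO.exists_sum_range_sub {f : ℕ → ℝ} (hf : LogO 2 f) :
    ∃ C, LogO 1 fun N => ∑ m ∈ Finset.range N, f m - C := by
  obtain ⟨p, hp⟩ := hf
  obtain ⟨K, hK0, hK⟩ := hp.exists_pos
  obtain ⟨D, hD0, hD⟩ := exists_one_add_log_pow_le p (by norm_num : (0 : ℝ) < 1 / 2)
  obtain ⟨M, hM⟩ := eventually_atTop.mp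
    ((hK.bound.and eventually_one_le_log).and (eventually_ge_atTop 1))
  -- Since `log N ≥ 1`, `log m ≤ log N (1 + log (m / N))`, and the second factor to the power `p` is
  -- at most `D √(m / N)`. This pulls `log^p N` out of the tail, leaving a summable `m^{-3/2}`.
  have hbd : ∀ N, M ≤ N → ∀ m, N ≤ m →
      |f m| ≤ K * D * Real.log N ^ p / √N * (√m / (m : ℝ) ^ 2) := by
    intro N hN m hm
    obtain ⟨⟨_, hlN⟩, h1N⟩ := hM N hN
    obtain ⟨⟨hfm, hlm⟩, h1m⟩ := hM m (hN.trans hm)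
    have hN0 : (0 : ℝ) < N := by exact_mod_cast h1N
    have hm0 : (0 : ℝ) < m := by exact_mod_cast h1m
    have hmN : (1 : ℝ) ≤ m / N := by
      rw [le_div_iff₀ hN0, one_mul]
      exact_mod_cast hm
    have hlog : Real.log m ≤ Real.log N * (1 + Real.log (m / N)) := by
      rw [Real.log_div hm0.ne' hN0.ne']
      have : Real.log N ≤ Real.log m := Real.log_le_log hN0 (by exact_mod_cast hm)
      nlinarith
    have h3 : Real.log m ^ p ≤ Real.log N ^ p * (D * (√m / √N)) := by
      calc _ ≤ (Real.log N * (1 + Real.log (m / N))) ^ p := by gcongr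
        _ ≤ _ := by
          rw [mul_pow]
          gcongr
          have := hD _ hmN
          rwa [← Real.sqrt_eq_rpow, Real.sqrt_div' _ hN0.le] at this
    have hlm0 : 0 ≤ Real.log m := zero_le_one.trans hlm
    rw [Real.norm_eq_abs, Real.norm_of_nonneg (by positivity)] at hfm
    refine hfm.trans ?_
    calc _ ≤ K * ((m : ℝ)⁻¹ ^ 2 * (Real.log N ^ p * (D * (√m / √N)))) := by gcongr
      _ = _ := by
        rw [inv_pow]
        ring
  have hpart : ∀ N, M ≤ N → ∀ L, |∑ m ∈ Finset.range (N + L), f m - ∑ m ∈ Finset.range N, f m| ≤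
      6 * (K * D) * ((N : ℝ)⁻¹ ^ 1 * Real.log N ^ p) := by
    intro N hN L
    obtain ⟨⟨_, hlN⟩, h1N⟩ := hM N hN
    have hN0 : (0 : ℝ) < N := by exact_mod_cast h1N
    have hlN0 : 0 ≤ Real.log N := zero_le_one.trans hlN
    rw [Finset.sum_range_add_sub_sum_range]
    calc _ ≤ ∑ i ∈ Finset.range L, |f (N + i)| := Finset.abs_sum_le_sum_abs _ _
      _ ≤ ∑ i ∈ Finset.range L, K * D * Real.log N ^ p / √N *
            (6 * (1 / √((N + i : ℕ) : ℝ) - 1 / √((N + (i + 1) : ℕ) : ℝ))) := by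
          refine Finset.sum_le_sum fun i _ => (hbd N hN _ (Nat.le_add_right N i)).trans ?_
          gcongr
          have := inv_sqrt_pow_three_le (m := ((N + i : ℕ) : ℝ)) (by exact_mod_cast by omega)
          refine this.trans (le_of_eq ?_)
          push_cast
          rw [add_assoc]
      _ = K * D * Real.log N ^ p / √N * (6 * (1 / √N - 1 / √((N + L : ℕ) : ℝ))) := by
          rw [← Finset.mul_sum, ← Finset.mul_sum,
            Finset.sum_range_sub' (fun i => 1 / √((N + i : ℕ) : ℝ))]
          simp
      _ ≤ K * D * Real.log N ^ p / √N * (6 * (1 / √N)) := by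
          gcongr
          have : 0 ≤ 1 / √((N + L : ℕ) : ℝ) := by positivity
          linarith
      _ = _ := by
          have : (√(N : ℝ))⁻¹ * (√(N : ℝ))⁻¹ = (N : ℝ)⁻¹ := by
            rw [← mul_inv, Real.mul_self_sqrt hN0.le]
          rw [pow_one, ← this]
          ring
  have hsum : Summable f := by
    refine summable_of_isBigO_nat (g := fun m : ℕ => (m : ℝ) ^ (-(3 / 2) : ℝ))
      (Real.summable_nat_rpow.mpr (by norm_num)) ?_
    refine IsBigO.of_bound (K * D * Real.log M ^ p / √M) ?_
    filter_upwards [eventually_ge_atTop M, eventually_ge_atTop 1] with m hm h1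
    have hm0 : (0 : ℝ) < m := by exact_mod_cast h1
    refine (hbd M le_rfl m hm).trans (le_of_eq ?_)
    rw [Real.norm_of_nonneg (by positivity), Real.sqrt_eq_rpow (m : ℝ), ← Real.rpow_natCast (m : ℝ) 2,
      ← Real.rpow_sub hm0]
    norm_num
  refine ⟨∑' m, f m, p, IsBigO.of_bound (6 * (K * D)) ?_⟩
  filter_upwards [eventually_ge_atTop M, eventually_one_le_log] with N hN hl
  have hl0 : 0 ≤ Real.log N := zero_le_one.trans hl
  rw [Real.norm_of_nonneg (by positivity : 0 ≤ (N : ℝ)⁻¹ ^ 1 * Real.log N ^ p), norm_sub_rev]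
  have ht : Tendsto (fun L => |∑ m ∈ Finset.range (N + L), f m - ∑ m ∈ Finset.range N, f m|) atTop
      (nhds |∑' m, f m - ∑ m ∈ Finset.range N, f m|) := by
    refine Tendsto.abs (Tendsto.sub_const ?_ _)
    have := hsum.hasSum.tendsto_sum_nat.comp (tendsto_add_atTop_nat N)
    refine this.congr fun L => ?_
    simp [add_comm]
  exact le_of_tendsto ht (Eventually.of_forall (hpart N hN))

theorem logO_log_succ_sub_log_sub_inv :
    LogO 2 fun m : ℕ => Real.log (m + 1 : ℕ) - Real.log m - (m : ℝ)⁻¹ := by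
  refine LogO.of_bound 1 (LogO.inv.pow 2) ?_
  filter_upwards [eventually_ge_atTop 1] with m hm
  have hm0 : (0 : ℝ) < m := by exact_mod_cast hm
  have h1 : Real.log (m + 1 : ℕ) - Real.log m ≤ (m : ℝ)⁻¹ := by
    push_cast
    rw [← Real.log_div (by positivity) (by positivity)]
    refine (Real.log_le_sub_one_of_pos (by positivity)).trans (le_of_eq ?_)
    field_simp
    ring
  have h2 : 1 - ((m : ℝ) / (m + 1)) ≤ Real.log (m + 1 : ℕ) - Real.log m := by
    push_cast
    rw [← Real.log_div (by positivity) (by positivity)]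
    refine le_trans (le_of_eq ?_) (Real.one_sub_inv_le_log_of_pos (by positivity))
    rw [inv_div]
  have h3 : (m : ℝ)⁻¹ - (1 - ((m : ℝ) / (m + 1))) ≤ (m : ℝ)⁻¹ ^ 2 := by
    have : (m : ℝ)⁻¹ - (1 - ((m : ℝ) / (m + 1))) = 1 / (m * (m + 1)) := by
      field_simp
      ring
    rw [this, inv_pow, one_div]
    refine inv_anti₀ (by positivity) ?_
    nlinarith
  rw [one_mul, abs_of_nonneg (by positivity : 0 ≤ (m : ℝ)⁻¹ ^ 2), abs_of_nonpos (by linarith)]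
  linarith

/-- First-order Taylor expansion: the remainder is quadratic in `h`. -/
theorem logO_eval_add_sub (Q : ℝ[X]) {u h : ℕ → ℝ} (hu : LogO 0 u) (hh : LogO 1 h) :
    LogO 2 fun N => Q.eval (u N + h N) - Q.eval (u N) - Q.derivative.eval (u N) * h N := by
  induction Q using Polynomial.induction_on' with
  | add P Q hP hQ =>
    refine (hP.add hQ).congr' (Eventually.of_forall fun N => ?_)
    simp only [eval_add, derivative_add]
    ring
  | monomial n a =>
    have key : LogO 2 fun N => (u N + h N) ^ n - u N ^ n - n * u N ^ (n - 1) * h N := by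
      induction n with
      | zero => simpa using LogO.zero 2
      | succ n ih =>
        have hpow : ∀ j, LogO 0 fun N => u N ^ j := fun j => by simpa using hu.pow j
        have h1 := hu.mul ih
        have h2 := hh.mul ((ih.mono one_le_two).add (((hpow (n - 1)).const_mul n).mul hh))
        refine ((h1.mono le_rfl).add h2).congr' (Eventually.of_forall fun N => ?_)
        simp only [Nat.add_sub_cancel]
        cases n with
        | zero => simp
        | succ n =>
          simp only [Nat.add_sub_cancel]
          push_cast
          ring
    refine (key.const_mul a).congr' (Eventually.of_forall fun N => ?_)
    simp only [eval_monomial, derivative_monomial]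
    ring

theorem exists_derivative_eq (P : ℝ[X]) : ∃ Q : ℝ[X], Q.derivative = P := by
  induction P using Polynomial.induction_on' with
  | add P Q hP hQ =>
    obtain ⟨P', rfl⟩ := hP
    obtain ⟨Q', rfl⟩ := hQ
    exact ⟨P' + Q', derivative_add⟩
  | monomial n a =>
    refine ⟨monomial (n + 1) (a / (n + 1)), ?_⟩
    rw [derivative_monomial]
    push_cast
    congr 1
    field_simp

/-! ### The regularized polynomials -/

theorem logO_one_div_add (x : ℝ) : LogO 1 fun m : ℕ => 1 / ((m : ℝ) + x) := by
  refine LogO.of_bound 2 LogO.inv ?_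
  filter_upwards [tendsto_natCast_atTop_atTop.eventually_ge_atTop (2 * |x| + 1)] with m hm
  have hm0 : (0 : ℝ) < m := by linarith [abs_nonneg x]
  have hmx : (m : ℝ) / 2 ≤ m + x := by linarith [neg_abs_le x]
  rw [abs_of_nonneg (one_div_nonneg.mpr (by linarith)), abs_of_nonneg (by positivity)]
  calc 1 / ((m : ℝ) + x) ≤ 1 / (m / 2) := one_div_le_one_div_of_le (by positivity) hmx
    _ = _ := by field_simp

theorem hurwitzSum_concat_eq_sum (x : ℝ) (l : Index) (c : ℕ+) (N : ℕ) :
    hurwitzSum x (l ++ [c]) (N + 1) = ∑ m ∈ Finset.range N,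
      (1 / (((m + 1 : ℕ) : ℝ) + x)) ^ (c : ℕ) * hurwitzSum x l (m + 1) := by
  induction N with
  | zero => rw [zero_add, hurwitzSum_one_of_ne_nil x (by simp), Finset.sum_range_zero]
  | succ N ih => rw [hurwitzSum_concat, ih, Finset.sum_range_succ]

theorem exists_logO_hurwitzSum_sub (x : ℝ) (l : Index) :
    ∃ P : ℝ[X], LogO 1 fun N => hurwitzSum x l N - P.eval (Real.log N) := by
  induction l using List.reverseRecOn with
  | nil => exact ⟨1, by simpa using LogO.zero 1⟩
  | append_singleton l c ih =>
    obtain ⟨P, hP⟩ := ih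
    -- The value at `m = 0` is set to zero because the sum starts at `m = 1`.
    set f : ℕ → ℝ := fun m =>
      if m = 0 then 0 else (1 / ((m : ℝ) + x)) ^ (c : ℕ) * hurwitzSum x l m with hf
    have hl : LogO 0 fun N => hurwitzSum x l N :=
      ((hP.mono zero_le_one).add (LogO.log.eval P)).congr'
        (Eventually.of_forall fun N => sub_add_cancel _ _)
    have hfe : f =ᶠ[atTop] fun m => (1 / ((m : ℝ) + x)) ^ (c : ℕ) * hurwitzSum x l m := by
      filter_upwards [eventually_ge_atTop 1] with m hm
      have : m ≠ 0 := by omega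
      simp only [hf, if_neg this]
    -- For `c = 1` the summand is `P(log m) / m` to order `m^{-2}`, hence the increment of `Q(log
    -- m)` with `Q' = P`. For `c ≥ 2` it is itself of order `m^{-2}`, and `Q = 0`.
    have main : ∃ Q : ℝ[X], LogO 2 fun m : ℕ =>
        f m - (Q.eval (Real.log (m + 1 : ℕ)) - Q.eval (Real.log m)) := by
      rcases eq_or_ne c 1 with rfl | hc
      · obtain ⟨Q, hQ⟩ := exists_derivative_eq P
        refine ⟨Q, ?_⟩
        have hh : LogO 1 fun m : ℕ => Real.log (m + 1 : ℕ) - Real.log m := by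
          refine ((logO_log_succ_sub_log_sub_inv.mono one_le_two).add LogO.inv).congr'
            (Eventually.of_forall fun m => ?_)
          ring
        have h1 := logO_eval_add_sub Q LogO.log hh
        have h2 := (LogO.log.eval P).mul logO_log_succ_sub_log_sub_inv
        have h3 := hP.mul LogO.inv
        have h4 := ((logO_one_div_add x).mul LogO.inv).mul (hl.const_mul (-x))
        have h5 := (((h4.mono le_rfl).add h3).sub (h2.mono (by norm_num))).sub h1
        refine h5.congr' ?_
        filter_upwards [hfe, eventually_ge_atTop 1,
          tendsto_natCast_atTop_atTop.eventually_gt_atTop (-x)] with m hm h1 hmx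
        have hm0 : (m : ℝ) ≠ 0 := by exact_mod_cast (by omega : m ≠ 0)
        have hmx0 : (m : ℝ) + x ≠ 0 := by linarith
        rw [hm, hQ, PNat.one_coe, pow_one]
        have e : 1 / ((m : ℝ) + x) * (m : ℝ)⁻¹ * (-x) = 1 / ((m : ℝ) + x) - (m : ℝ)⁻¹ := by
          field_simp
          ring
        rw [add_sub_cancel]
        linear_combination hurwitzSum x l m * e
      · refine ⟨0, ?_⟩
        have hc2 : 2 ≤ 1 * (c : ℕ) + 0 := by
          have h1 := c.pos
          have h2 : (c : ℕ) ≠ 1 := fun h => hc (PNat.coe_injective h)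
          omega
        simpa using ((((logO_one_div_add x).pow c).mul hl).mono hc2).congr' hfe.symm
    obtain ⟨Q, hQ⟩ := main
    obtain ⟨C, hC⟩ := hQ.exists_sum_range_sub
    -- The telescoping sum starts at `m = 0`, where `Real.log 0 = 0`; hence the correction `Q.eval
    -- 0`.
    refine ⟨Q + Polynomial.C (C - Q.eval 0), hC.congr' ?_⟩
    filter_upwards [eventually_ge_atTop 1] with N hN
    obtain ⟨N, rfl⟩ := Nat.exists_eq_add_of_le' hN
    rw [Finset.sum_sub_distrib, Finset.sum_range_sub (fun m : ℕ => Q.eval (Real.log m)),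
      hurwitzSum_concat_eq_sum, Finset.sum_range_succ']
    simp only [hf, if_true, Nat.succ_ne_zero, if_false, add_zero, eval_add, eval_C, Nat.cast_zero,
      Real.log_zero]
    ring

theorem eq_C_of_tendsto_eval {P : ℝ[X]} {u : ℕ → ℝ} {c : ℝ} (hu : Tendsto u atTop atTop)
    (h : Tendsto (fun N => P.eval (u N)) atTop (nhds c)) : P = Polynomial.C c := by
  by_cases hdeg : 0 < P.degree
  · exact absurd h.abs (not_tendsto_nhds_of_tendsto_atTop ((P.abs_tendsto_atTop hdeg).comp hu) _)
  · obtain ⟨a, rfl⟩ : ∃ a, P = Polynomial.C a := ⟨_, eq_C_of_degree_le_zero (not_lt.mp hdeg)⟩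
    simp only [eval_C] at h
    rw [tendsto_nhds_unique h tendsto_const_nhds]

/-- Positivity of the exponent costs nothing, since it may always be raised. -/
theorem isStuffleReg_iff (x : ℝ) (l : Index) (P : ℝ[X]) :
    IsStuffleReg x l P ↔
      LogO 1 fun N => hurwitzSum x l N - P.eval (Real.log N - digamma (1 + x)) := by
  simp only [IsStuffleReg, LogO, pow_one]
  constructor
  · rintro ⟨p, _, h⟩
    exact ⟨p, h⟩
  · rintro ⟨p, h⟩
    refine ⟨p + 1, p.succ_pos, h.trans ?_⟩
    simpa using isBigO_inv_pow_mul_log_pow (s := 1) le_rfl p.le_succ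

theorem tendsto_log_sub_atTop (d : ℝ) :
    Tendsto (fun N : ℕ => Real.log N - d) atTop atTop := by
  simpa only [sub_eq_add_neg, Function.comp_def] using tendsto_atTop_add_const_right atTop (-d)
    (Real.tendsto_log_atTop.comp tendsto_natCast_atTop_atTop)

theorem existsUnique_isStuffleReg (x : ℝ) (l : Index) : ∃! P : ℝ[X], IsStuffleReg x l P := by
  obtain ⟨P, hP⟩ := exists_logO_hurwitzSum_sub x l
  refine existsUnique_of_exists_of_unique
    ⟨P.comp (X + Polynomial.C (digamma (1 + x))), ?_⟩ fun P Q hP hQ => ?_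
  · rw [isStuffleReg_iff]
    simpa using hP
  · rw [isStuffleReg_iff] at hP hQ
    have h := (hQ.sub hP).tendsto_zero
    have h2 : Tendsto (fun N : ℕ => (P - Q).eval (Real.log N - digamma (1 + x))) atTop (nhds 0) := by
      refine h.congr fun N => ?_
      rw [eval_sub]
      ring
    have := eq_C_of_tendsto_eval (tendsto_log_sub_atTop _) h2
    rwa [C_0, sub_eq_zero] at this

theorem logO_hurwitzSum_sub_stuffleReg (x : ℝ) (l : Index) :
    LogO 1 fun N => hurwitzSum x l N -
      (stuffleReg x l).eval (Real.log N - digamma (1 + x)) :=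
  (isStuffleReg_iff x l _).mp (Classical.epsilon_spec (existsUnique_isStuffleReg x l).exists)

theorem logO_hurwitzSum (x : ℝ) (l : Index) : LogO 0 fun N => hurwitzSum x l N := by
  obtain ⟨P, hP⟩ := exists_logO_hurwitzSum_sub x l
  exact ((hP.mono zero_le_one).add (LogO.log.eval P)).congr'
    (Eventually.of_forall fun N => sub_add_cancel _ _)

theorem digamma_one : digamma 1 = -Real.eulerMascheroniConstant := by
  rw [digamma, Real.Gamma_one, div_one, Real.hasDerivAt_Gamma_one.deriv]

theorem logO_sum_star_sub_stuffleRegStar (k : Index) :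
    LogO 1 fun N => ((star k).map fun l => hurwitzSum 0 l N).sum -
      (stuffleRegStar k).eval (Real.log N + Real.eulerMascheroniConstant) := by
  refine (LogO.multiset_sum (star k) fun l _ => logO_hurwitzSum_sub_stuffleReg 0 l).congr'
    (Eventually.of_forall fun N => ?_)
  simp only [add_zero, digamma_one, sub_neg_eq_add]
  rw [Multiset.sum_map_sub, stuffleRegStar, ← coe_evalRingHom, map_multiset_sum, Multiset.map_map]
  rfl

/-! ### Multiple zeta values as limits of finite sums -/

theorem injective_coe_strictMono (r : ℕ) :
    Function.Injective fun (m : {m : Fin r → ℕ+ // StrictMono m}) i => (m.1 i : ℕ) :=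
  fun _ _ h => Subtype.ext (funext fun i => PNat.coe_injective (congrFun h i))

/-- The tuples `0 < m₁ < ⋯ < m_r < N`. -/
def tuplesBelow (l : Index) (N : ℕ) : Finset {m : Fin l.length → ℕ+ // StrictMono m} :=
  open Classical in
  ((Fintype.piFinset fun _ : Fin l.length => Finset.Ioo 0 N).filter StrictMono).preimage
    (fun m i => (m.1 i : ℕ))
    (injective_coe_strictMono l.length).injOn

theorem mem_tuplesBelow {l : Index} {N : ℕ} {m : {m : Fin l.length → ℕ+ // StrictMono m}} :
    m ∈ tuplesBelow l N ↔ ∀ i, (m.1 i : ℕ) < N := by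
  rw [tuplesBelow, Finset.mem_preimage, Finset.mem_filter, Fintype.mem_piFinset]
  exact ⟨fun h i => (Finset.mem_Ioo.mp (h.1 i)).2,
    fun h => ⟨fun i => Finset.mem_Ioo.mpr ⟨(m.1 i).pos, h i⟩, fun _ _ hij => m.2 hij⟩⟩

theorem sum_tuplesBelow (l : Index) (N : ℕ) :
    ∑ m ∈ tuplesBelow l N, mzvTerm l m = hurwitzSum 0 l N := by
  classical
  have := Finset.sum_preimage (fun (m : {m : Fin l.length → ℕ+ // StrictMono m}) i => (m.1 i : ℕ))
    ((Fintype.piFinset fun _ : Fin l.length => Finset.Ioo 0 N).filter StrictMono)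
    (injective_coe_strictMono l.length).injOn
    (fun m => ∏ i, 1 / ((m i : ℝ) + 0) ^ (l.get i : ℕ)) (by
      intro m hm hm'
      simp only [Finset.mem_filter, Fintype.mem_piFinset, Finset.mem_Ioo] at hm
      refine absurd ⟨⟨fun i => ⟨m i, (hm.1 i).1⟩, fun i j hij => ?_⟩, rfl⟩ hm'
      exact hm.2 hij)
  unfold hurwitzSum
  rw [← this]
  refine Finset.sum_congr rfl fun m _ => ?_
  simp only [add_zero]
  rfl

theorem tendsto_tuplesBelow (l : Index) : Tendsto (tuplesBelow l) atTop atTop := by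
  refine tendsto_atTop_finset_of_monotone ?_ fun m => ?_
  · intro M N h m hm
    rw [mem_tuplesBelow] at hm ⊢
    exact fun i => (hm i).trans_le h
  · refine ⟨∑ i, (m.1 i : ℕ) + 1, ?_⟩
    rw [mem_tuplesBelow]
    intro i
    exact Nat.lt_succ_of_le
      (Finset.single_le_sum (f := fun i => (m.1 i : ℕ)) (fun _ _ => Nat.zero_le _)
        (Finset.mem_univ i))

theorem mzvTerm_nonneg (l : Index) (m : {m : Fin l.length → ℕ+ // StrictMono m}) :
    0 ≤ mzvTerm l m := Finset.prod_nonneg fun i _ => by positivity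

/-- The terms are nonnegative, so convergence along the exhaustion `tuplesBelow` is unconditional.
-/
theorem hasSum_mzvTerm {l : Index} {a : ℝ} (h : Tendsto (hurwitzSum 0 l) atTop (nhds a)) :
    HasSum (mzvTerm l) a := by
  have hmono : Monotone (hurwitzSum 0 l) := by
    intro M N hMN
    rw [← sum_tuplesBelow, ← sum_tuplesBelow]
    refine Finset.sum_le_sum_of_subset_of_nonneg (fun m hm => ?_) fun m _ _ => mzvTerm_nonneg l m
    rw [mem_tuplesBelow] at hm ⊢
    exact fun i => (hm i).trans_le hMN
  have hs : Summable (mzvTerm l) := by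
    refine summable_of_sum_le (c := a) (mzvTerm_nonneg l) fun u => ?_
    obtain ⟨N, hN⟩ := ((tendsto_tuplesBelow l).eventually_ge_atTop u).exists
    refine (Finset.sum_le_sum_of_subset_of_nonneg hN fun m _ _ => mzvTerm_nonneg l m).trans ?_
    rw [sum_tuplesBelow]
    exact hmono.ge_of_tendsto h N
  have ht := hs.hasSum.comp (tendsto_tuplesBelow l)
  have e : (fun s : Finset _ => ∑ m ∈ s, mzvTerm l m) ∘ tuplesBelow l = hurwitzSum 0 l :=
    funext fun N => sum_tuplesBelow l N
  rw [e] at ht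
  rw [tendsto_nhds_unique h ht]
  exact hs.hasSum

theorem summable_pow_mul_hurwitzSum (w : Index) (c : ℕ+) :
    Summable fun n : ℕ => (1 / ((n : ℝ) + 1)) ^ ((1 + c : ℕ+) : ℕ) * hurwitzSum 0 w (n + 1) := by
  have h := ((logO_one_div_add 0).pow (1 + c : ℕ+)).mul (logO_hurwitzSum 0 w)
  have hc : 2 ≤ 1 * ((1 + c : ℕ+) : ℕ) + 0 := by
    have := c.pos
    rw [PNat.add_coe, PNat.one_coe]
    omega
  obtain ⟨C, hC⟩ := (h.mono hc).exists_sum_range_sub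
  have ht : Tendsto (fun N => ∑ m ∈ Finset.range N,
      (1 / ((m : ℝ) + 0)) ^ ((1 + c : ℕ+) : ℕ) * hurwitzSum 0 w m) atTop (nhds C) := by
    simpa using hC.tendsto_zero.add_const C
  have hs := (hasSum_iff_tendsto_nat_of_nonneg (fun m => mul_nonneg (by positivity)
    (hurwitzSum_nonneg w m)) C).mpr ht
  refine ((summable_nat_add_iff 1).mpr hs.summable).congr fun n => ?_
  simp

theorem hasSum_mzvTerm_concat (w : Index) (c : ℕ+) :
    HasSum (mzvTerm (w ++ [1 + c]))
      (∑' n : ℕ, (1 / ((n : ℝ) + 1)) ^ ((1 + c : ℕ+) : ℕ) * hurwitzSum 0 w (n + 1)) := by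
  refine hasSum_mzvTerm ?_
  rw [← tendsto_add_atTop_iff_nat 1]
  refine (summable_pow_mul_hurwitzSum w c).hasSum.tendsto_sum_nat.congr fun N => ?_
  rw [hurwitzSum_concat_eq_sum]
  push_cast
  simp

theorem hasSum_mzv (w : Index) (c : ℕ+) :
    HasSum (fun n : ℕ => (1 / ((n : ℝ) + 1)) ^ ((1 + c : ℕ+) : ℕ) * hurwitzSum 0 w (n + 1))
      (mzv (w ++ [1 + c])) := by
  rw [mzv, (hasSum_mzvTerm_concat w c).tsum_eq]
  exact (summable_pow_mul_hurwitzSum w c).hasSum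

/-! ### The Taylor series of the Kawashima function -/

theorem circledast_replicate (j : ℕ) (u : Index) (b : ℕ+) :
    circledast (List.replicate (j + 1) 1) (u ++ [b]) =
      (stuffle (List.replicate j 1) u).map (· ++ [1 + b]) := by
  rw [List.replicate_succ', circledast]
  simp

theorem summable_mzvTerm_of_mem_kawashimaSum {k l : Index} {m : ℕ} (h : l ∈ kawashimaSum k m) :
    Summable (mzvTerm l) := by
  obtain ⟨v, _, hv⟩ := Multiset.mem_bind.mp h
  cases m with
  | zero => simp [circledast] at hv
  | succ j =>
    rcases List.eq_nil_or_concat' v with rfl | ⟨u, b, rfl⟩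
    · simp [circledast] at hv
    · rw [circledast_replicate] at hv
      obtain ⟨w, _, rfl⟩ := Multiset.mem_map.mp hv
      exact (hasSum_mzvTerm_concat w b).summable

theorem hasSum_multiset_sum {ι : Type*} (s : Multiset ι) {f : ι → ℕ → ℝ} {a : ι → ℝ}
    (h : ∀ i ∈ s, HasSum (f i) (a i)) :
    HasSum (fun n => (s.map fun i => f i n).sum) (s.map a).sum := by
  induction s using Multiset.induction_on with
  | empty => simp
  | cons i s ih =>
    simp only [Multiset.map_cons, Multiset.sum_cons]
    exact (h i (Multiset.mem_cons_self i s)).add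
      (ih fun j hj => h j (Multiset.mem_cons_of_mem hj))

/-- Fix the largest variable `n + 1`. The stuffle of the remaining entries becomes a product of
finite sums; the factor from the second word, with its power of `n + 1`, is an increment of a finite
sum, and summing over `star` gives the coefficient. -/
theorem hasSum_kawashimaSum {k : Index} (hk : k ≠ []) (j : ℕ) :
    HasSum (fun n : ℕ => 1 / ((n : ℝ) + 1) * hurwitzSum 0 (List.replicate j 1) (n + 1) *
      kawashimaCoeff k n) ((kawashimaSum k (j + 1)).map mzv).sum := by
  have h : ∀ l ∈ star (hoffmanDual k), HasSum
      (fun n : ℕ => 1 / ((n : ℝ) + 1) * hurwitzSum 0 (List.replicate j 1) (n + 1) *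
        (hurwitzSum 0 l (n + 2) - hurwitzSum 0 l (n + 1)))
      ((circledast (List.replicate (j + 1) 1) l).map mzv).sum := by
    intro l hl
    rcases List.eq_nil_or_concat' l with rfl | ⟨u, b, rfl⟩
    · exact absurd rfl (ne_nil_of_mem_star (hoffmanDual_ne_nil hk) hl)
    · rw [circledast_replicate, Multiset.map_map]
      have := hasSum_multiset_sum (stuffle (List.replicate j 1) u) fun w _ => hasSum_mzv w b
      refine this.congr_fun ?_
      intro n
      rw [Multiset.sum_map_mul_left, hurwitzSum_stuffle, hurwitzSum_concat, add_sub_cancel_left,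
        PNat.add_coe, PNat.one_coe, pow_add, pow_one]
      push_cast
      rw [add_zero]
      ring
  have := hasSum_multiset_sum _ h
  rw [kawashimaSum, Multiset.map_bind, Multiset.sum_bind]
  refine this.congr_fun ?_
  intro n
  rw [Multiset.sum_map_mul_left, Multiset.sum_map_sub]
  rfl

/-- The generating polynomial at `t = 1` has the same value with cutoffs `j` and `j + 1`. -/
theorem hurwitzSum_replicate_eq_zero {n j : ℕ} (h : n < j) :
    hurwitzSum 0 (List.replicate j 1) (n + 1) = 0 := by
  have h1 := prod_one_add_eq_sum_hurwitzSum 1 n j h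
  have h2 := prod_one_add_eq_sum_hurwitzSum 1 n (j + 1) (h.trans j.lt_succ_self)
  rw [Finset.sum_range_succ, ← h1] at h2
  simpa using h2

/-- The Taylor expansion of a binomial coefficient. -/
theorem hasSum_signedBinom_succ (n : ℕ) (x : ℝ) :
    HasSum (fun j : ℕ => (-1) ^ j * x ^ (j + 1) *
      (1 / ((n : ℝ) + 1) * hurwitzSum 0 (List.replicate j 1) (n + 1)))
      (-signedBinom (n + 1) x) := by
  have e : -signedBinom (n + 1) x = ∑ j ∈ Finset.range (n + 1), (-1) ^ j * x ^ (j + 1) *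
      (1 / ((n : ℝ) + 1) * hurwitzSum 0 (List.replicate j 1) (n + 1)) := by
    have h1 := succ_mul_signedBinom_succ n x
    have h2 : signedBinom n (x - 1) = ∏ i ∈ Finset.range n, (1 + -x / ((i : ℝ) + 1)) := by
      refine Finset.prod_congr rfl fun i _ => ?_
      field_simp
      ring
    rw [h2, prod_one_add_eq_sum_hurwitzSum (-x) n (n + 1) n.lt_succ_self] at h1
    have h3 : -signedBinom (n + 1) x = x / ((n : ℝ) + 1) * ∑ j ∈ Finset.range (n + 1),
        (-x) ^ j * hurwitzSum 0 (List.replicate j 1) (n + 1) := by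
      field_simp
      linear_combination -h1
    rw [h3, Finset.mul_sum]
    refine Finset.sum_congr rfl fun j _ => ?_
    rw [neg_pow x j, pow_succ]
    ring
  rw [e]
  refine hasSum_sum_of_ne_finset_zero fun j hj => ?_
  rw [hurwitzSum_replicate_eq_zero (by simpa using hj), mul_zero, mul_zero]

theorem hasSum_kawashimaTerm {k : Index} (hk : k ≠ []) {x : ℝ} (hx : |x| < 1) :
    HasSum (kawashimaTerm k x) (kawashimaNewton k x) := by
  have ha := logBounded_kawashimaCoeff hk
  set g : ℝ → ℕ × ℕ → ℝ := fun x p => (-1) ^ p.2 * x ^ (p.2 + 1) *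
      (1 / ((p.1 : ℝ) + 1) * hurwitzSum 0 (List.replicate p.2 1) (p.1 + 1)) *
      kawashimaCoeff k p.1 with hg
  have hrow : ∀ (x : ℝ) (n : ℕ), HasSum (fun j => g x (n, j))
      (-signedBinom (n + 1) x * kawashimaCoeff k n) :=
    fun x n => (hasSum_signedBinom_succ n x).mul_right _
  -- At `-|x|` all terms have the same sign, so the row sums of absolute values are again binomial
  -- coefficients. Their Newton series converges because `-|x| > -1`, which justifies the
  -- interchange.
  have habs : ∀ p, |g x p| = -g (-|x|) p := by
    intro p
    have h1 := hurwitzSum_nonneg (List.replicate p.2 1) (p.1 + 1)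
    have h2 := kawashimaCoeff_nonneg hk p.1
    simp only [hg]
    rw [abs_mul, abs_mul, abs_mul, abs_of_nonneg h2, abs_of_nonneg (by positivity :
      0 ≤ 1 / ((p.1 : ℝ) + 1) * hurwitzSum 0 (List.replicate p.2 1) (p.1 + 1)), abs_pow, abs_pow,
      abs_neg, abs_one, one_pow, one_mul, neg_pow |x|, ← mul_assoc ((-1 : ℝ) ^ p.2), ← pow_add,
      Odd.neg_one_pow ⟨p.2, by ring⟩]
    ring
  have hsum : Summable (g x) := by
    refine Summable.of_abs ((summable_prod_of_nonneg fun p => abs_nonneg _).mpr ⟨fun n => ?_, ?_⟩)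
    · simp only [habs]
      exact (hrow _ n).summable.neg
    · simp only [habs]
      have h := ha.summable_signedBinom_succ (z := -|x|) (by linarith)
      refine h.congr fun n => ?_
      rw [tsum_neg, (hrow _ n).tsum_eq]
      ring
  have h1 := hsum.hasSum.prod_fiberwise (hrow x)
  have h2 : ∑' p, g x p = kawashimaNewton k x := by
    rw [kawashimaNewton_of_ne_nil hk, newton, ← tsum_neg, ← h1.tsum_eq]
    exact tsum_congr fun n => by ring
  have h3 := (Equiv.prodComm ℕ ℕ).hasSum_iff.mpr hsum.hasSum
  rw [h2] at h3
  refine h3.prod_fiberwise fun j => ?_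
  have h4 := (hasSum_kawashimaSum hk j).mul_left ((-1) ^ j * x ^ (j + 1))
  rw [kawashimaTerm, mul_right_comm]
  refine h4.congr_fun ?_
  intro n
  simp only [hg, Function.comp_apply, Equiv.prodComm_apply, Prod.swap_prod_mk]
  ring

theorem kawashimaF_eq_kawashimaNewton (k : Index) {x : ℝ} (hx : |x| < 1) :
    kawashimaF k x = kawashimaNewton k x := by
  by_cases hk : k = []
  · simp [kawashimaF, hk]
  · rw [kawashimaF, if_neg hk, (hasSum_kawashimaTerm hk hx).tsum_eq]

/-! ### The formula -/

/-- The arguments are shifted because a Hurwitz sum at `N` runs over `m < N`, a star sum at `N - 1`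
over `m ≤ N - 1`. -/
theorem logO_starSum_increment (k : Index) :
    LogO 1 fun N => starSum k (N - 1) - starSum k (N - 2) := by
  rcases List.eq_nil_or_concat' k with rfl | ⟨w, c, rfl⟩
  · simpa using LogO.zero 1
  · have hlog : LogO 0 fun N : ℕ => (1 + Real.log N) ^ w.length := by
      simpa using ((LogO.const 1).add LogO.log).pow w.length
    refine LogO.of_bound 2 (LogO.inv.mul hlog) ?_
    filter_upwards [eventually_ge_atTop 2] with N hN
    obtain ⟨N, rfl⟩ := Nat.exists_eq_add_of_le' hN
    have h0 : 0 ≤ Real.log (N + 2 : ℕ) := Real.log_natCast_nonneg _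
    have h1 := starSum_nonneg w (N + 1)
    rw [show N + 2 - 1 = N + 1 by omega, show N + 2 - 2 = N by omega, starSum_concat_succ,
      add_sub_cancel_left, abs_of_nonneg (by positivity), abs_of_nonneg (by positivity),
      ← mul_assoc]
    refine mul_le_mul ((one_div_succ_pow_le N c).trans ?_) ((starSum_le w (N + 1)).trans ?_) h1
      (by positivity)
    · push_cast
      rw [← div_eq_mul_inv, div_le_div_iff₀ (by positivity) (by positivity)]
      linarith [N.cast_nonneg (α := ℝ)]
    · have := Real.log_natCast_nonneg (N + 1)
      gcongr
      omega

/-- In the exact identity, replacing `F(·; x + N - 1)` by a star sum costs `O(N⁻¹ log^p N)`, which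
survives multiplication by Hurwitz sums of logarithmic growth. -/
theorem tendsto_sum_starSum_mul_hurwitzSum (k : Index) {x : ℝ} (hx : -1 < x) :
    Tendsto (fun N => ∑ j ∈ Finset.range (k.length + 1), (-1) ^ (k.length - j) *
      starSum (k.take j) (N - 1) * hurwitzSum x (k.drop j).reverse N) atTop
      (nhds (kawashimaNewton k x)) := by
  have h : LogO 1 fun N => ∑ j ∈ Finset.range (k.length + 1), (-1) ^ (k.length - j) *
      ((kawashimaNewton (k.take j) (x + (N - 1 : ℕ)) - starSum (k.take j) (N - 1)) *
        hurwitzSum x (k.drop j).reverse N) := by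
    refine LogO.sum _ fun j _ => LogO.const_mul _ ?_
    refine (LogO.mul ?_ (logO_hurwitzSum x (k.drop j).reverse)).mono le_rfl
    obtain ⟨C, hC⟩ := exists_abs_kawashimaNewton_sub_starSum_le (k.take j) hx
    refine LogO.of_bound 1 ((logO_starSum_increment (k.take j)).const_mul C) ?_
    filter_upwards [eventually_ge_atTop 2] with N hN
    obtain ⟨N, rfl⟩ := Nat.exists_eq_add_of_le' hN
    rw [one_mul]
    exact (hC N).trans (le_abs_self _)
  have h2 := h.tendsto_zero.const_sub (kawashimaNewton k x)
  rw [sub_zero] at h2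
  refine h2.congr' ?_
  filter_upwards [eventually_ge_atTop 1] with N hN
  obtain ⟨N, rfl⟩ := Nat.exists_eq_add_of_le' hN
  rw [kawashimaNewton_eq_sum k hx N, ← Finset.sum_sub_distrib]
  refine Finset.sum_congr rfl fun j _ => ?_
  simp only [Nat.add_sub_cancel]
  ring

theorem C_kawashimaF_eq (k : Index) {x : ℝ} (hx : |x| < 1) :
    Polynomial.C (kawashimaF k x) =
      ∑ j ∈ Finset.range (k.length + 1),
        (-1 : ℝ[X]) ^ (k.length - j) * stuffleRegStar (k.take j) *
          (stuffleReg x (k.drop j).reverse).comp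
            (X - Polynomial.C (Real.eulerMascheroniConstant + digamma (1 + x))) := by
  set γ := Real.eulerMascheroniConstant
  symm
  rw [kawashimaF_eq_kawashimaNewton k hx]
  -- At `T = log N + γ` the star factor has its own argument `log N - ψ(1)`, and `T - γ - ψ(1 + x)`
  -- becomes `log N - ψ(1 + x)`.
  refine eq_C_of_tendsto_eval (u := fun N : ℕ => Real.log N + γ) (by
    simpa using tendsto_log_sub_atTop (-γ)) ?_
  have h : LogO 1 fun N => ∑ j ∈ Finset.range (k.length + 1), (-1) ^ (k.length - j) *
      (((star (k.take j)).map fun l => hurwitzSum 0 l N).sum *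
          hurwitzSum x (k.drop j).reverse N -
        (stuffleRegStar (k.take j)).eval (Real.log N + γ) *
          (stuffleReg x (k.drop j).reverse).eval (Real.log N - digamma (1 + x))) := by
    refine LogO.sum _ fun j _ => LogO.const_mul _ ?_
    have h1 := (logO_sum_star_sub_stuffleRegStar (k.take j)).mul
      (logO_hurwitzSum x (k.drop j).reverse)
    have h2 := ((LogO.log.add (LogO.const γ)).eval (stuffleRegStar (k.take j))).mul
      (logO_hurwitzSum_sub_stuffleReg x (k.drop j).reverse)
    refine ((h1.mono le_rfl).add (h2.mono le_rfl)).congr' (Eventually.of_forall fun N => ?_)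
    ring
  have h3 := (tendsto_sum_starSum_mul_hurwitzSum k (abs_lt.mp hx).1).sub h.tendsto_zero
  rw [sub_zero] at h3
  refine h3.congr' ?_
  filter_upwards [eventually_ge_atTop 1] with N hN
  obtain ⟨N, rfl⟩ := Nat.exists_eq_add_of_le' hN
  rw [← Finset.sum_sub_distrib, eval_finsetSum]
  refine Finset.sum_congr rfl fun j _ => ?_
  simp only [Nat.add_sub_cancel, starSum, eval_mul, eval_pow, eval_neg, eval_one, eval_comp,
    eval_sub, eval_X, eval_C]
  rw [show Real.log (N + 1 : ℕ) + γ - (γ + digamma (1 + x)) =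
    Real.log (N + 1 : ℕ) - digamma (1 + x) by ring]
  ring

end Kawashima

end

/-- The first three conjuncts say that the objects in the formula are well defined: the regularized
polynomials exist and are unique, the multiple zeta series converge, and so does the Taylor series
of the Kawashima function. The last one is the formula, an identity in `ℝ[T]`. -/
theorem theorem3p1 (k : List ℕ+) (x : ℝ) (hx : |x| < 1) :
    (∀ l : List ℕ+, (∃! P : Polynomial ℝ, Kawashima.IsStuffleReg x l P) ∧
      (∃! P : Polynomial ℝ, Kawashima.IsStuffleReg 0 l P)) ∧
    (∀ m : ℕ, ∀ l ∈ Kawashima.kawashimaSum k m, Summable (Kawashima.mzvTerm l)) ∧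
    (k ≠ [] → Summable (Kawashima.kawashimaTerm k x)) ∧
    Polynomial.C (Kawashima.kawashimaF k x) =
      ∑ j ∈ Finset.range (k.length + 1),
        (-1 : Polynomial ℝ) ^ (k.length - j) * Kawashima.stuffleRegStar (k.take j) *
          (Kawashima.stuffleReg x (k.drop j).reverse).comp
            (Polynomial.X - Polynomial.C
              (Real.eulerMascheroniConstant + Kawashima.digamma (1 + x))) :=
  ⟨fun l => ⟨Kawashima.existsUnique_isStuffleReg x l, Kawashima.existsUnique_isStuffleReg 0 l⟩,
    fun _ _ h => Kawashima.summable_mzvTerm_of_mem_kawashimaSum h,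
    fun hk => (Kawashima.hasSum_kawashimaTerm hk hx).summable,
    Kawashima.C_kawashimaF_eq k hx⟩
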